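/- Consider a stochastic multi-armed bandit with $K\ge 2$ arms. An environment is a tuple $\theta=(\nu_1,\dots,\nu_K)$ of probability measures on $[0,1]$, and it belongs to a set $\Theta=\Theta_1\times\dots\times\Theta_K$, where each $\Theta_k$ contains all the distributions $p\delta_a+(1-p)\delta_b$ with $p,a,b\in[0,1]$. Under $\mathbb P_\theta$ the rewards $X_{k,s}$ ($1\le k\le K$, $s\ge 1$) are independent, $X_{k,s}$ having law $\nu_k$. At each round $t\ge 1$ a policy chooses an arm $I_t$, possibly at random, on the basis of the past arms and past rewards only, and receives $X_{I_t,T_{I_t}(t)}$, where $T_k(t)=\#\{s\le t: I_s=k\}$. Let $\mu_k=\int x\,d\nu_k(x)$, $\mu^*=\max_k\mu_k$, $\Delta_k=\mu^*-\mu_k$, fix an arm $k^*$ with $\mu_{k^*}=\mu^*$, and let $$R_n=\sum_{t=1}^n X_{k^*,t}-\sum_{t=1}^n X_{I_t,T_{I_t}(t)}$$ be the regret after $n$ rounds. For $\alpha\in[0,1]$ a policy is called $\alpha$-consistent if $\mathbb E_\theta[R_n]=o(n^a)$ as $n\to\infty$, for every $a>\alpha$ and every $\theta\in\Theta$. The policy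 UCB($\rho$) draws each arm once and then, at each round $t>K$, draws an arm $$I_t\in\operatorname*{argmax}_{1\le k\le K}\left\{\hat X_{k,T_k(t-1)}+\sqrt{\frac{\rho\log t}{T_k(t-1)}}\right\},\qquad \hat X_{k,s}=\frac1s\sum_{u=1}^s X_{k,u},$$ with any order of the first $K$ draws and any rule for breaking ties. Let $\rho\in(0,\tfrac12)$. Then for UCB($\rho$), every $\theta\in\Theta$, every $\beta\in(0,1)$ and every $n\ge1$, $$\mathbb E_\theta[R_n]\le\sum_{k:\Delta_k>0}\left[\frac{4\log n}{\Delta_k}+2\Delta_k\left(\frac{\log n}{\log(1/\beta)}+1\right)\frac{n^{1-2\rho\beta}}{1-2\rho\beta}\right],$$ and consequently UCB($\rho$) is $(1-2\rho)$-consistent. Conversely, for every $\varepsilon>0$ there exists $\theta\in\Theta$, which can be chosen independently of the order of the first draws and of the tie-breaking rule, such that $$\lim_{n\to+\infty}\frac{\mathbb E_\theta[R_n]}{n^{1-2\rho-\varepsilon}}=+\infty.$$ -/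

import Mathlib

open MeasureTheory Filter Asymptotics

namespace Bandit

noncomputable section

/-- An environment with `K` arms: each arm has a reward distribution, a probability on `[0,1]`. -/
abbrev Env (K : ℕ) : Type := Fin K → ProbabilityMeasure unitInterval

/-- The probability `p δ_a + (1 - p) δ_b` on `[0,1]`. -/
def twoPoint (p a b : unitInterval) : ProbabilityMeasure unitInterval :=
  ⟨ENNReal.ofReal (p : ℝ) • Measure.dirac a + ENNReal.ofReal (1 - (p : ℝ)) • Measure.dirac b, by
    constructor
    simp only [Measure.coe_add, Measure.coe_smul, Pi.add_apply, Pi.smul_apply, measure_univ,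
      smul_eq_mul, mul_one]
    rw [← ENNReal.ofReal_add p.2.1 (sub_nonneg.2 p.2.2)]
    simp⟩

/-- The past decisions and outcomes after `t` rounds: the arm drawn and the reward received. -/
abbrev History (K t : ℕ) : Type := Fin t → Fin K × unitInterval

/-- A (possibly randomized) policy: after each history of length `t`, a probability on the arms,
from which the arm of round `t + 1` is drawn. Deterministic choices are Dirac masses `PMF.pure`. -/
structure Policy (K : ℕ) where
  choice : ∀ t : ℕ, History K t → PMF (Fin K)
  measurable_choice : ∀ (t : ℕ) (k : Fin K), Measurable fun h : History K t => choice t h k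

/-- The number of times arm `k` was pulled in the history `h`. -/
def pulls {K t : ℕ} (h : History K t) (k : Fin K) : ℕ :=
  (Finset.univ.filter fun i => (h i).1 = k).card

/-- The empirical mean of the rewards of arm `k` in the history `h`. -/
def empMean {K t : ℕ} (h : History K t) (k : Fin K) : ℝ :=
  (∑ i ∈ Finset.univ.filter (fun i => (h i).1 = k), ((h i).2 : ℝ)) / (pulls h k : ℝ)

/-- The index of arm `k` at round `t + 1`, given the history `h` of the first `t` rounds. -/
def ucbIndex (ρ : ℝ) {K t : ℕ} (h : History K t) (k : Fin K) : ℝ :=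
  empMean h k + Real.sqrt (ρ * Real.log ((t : ℝ) + 1) / (pulls h k : ℝ))

/-- `σ` is a `UCB(ρ)` policy: it first draws each arm once (in any order), and then always draws
an arm of maximal index (ties being broken in any way, possibly at random). -/
def IsUCB (ρ : ℝ) {K : ℕ} (σ : Policy K) : Prop :=
  ∀ (t : ℕ) (h : History K t), ∀ k ∈ (σ.choice t h).support,
    ((∃ j, pulls h j = 0) → pulls h k = 0) ∧
    ((∀ j, pulls h j ≠ 0) → ∀ j, ucbIndex ρ h j ≤ ucbIndex ρ h k)

/-- Sampling from a probability `p` on the arms by inversion of the distribution function: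
the least arm `k` with `u < p 0 + ⋯ + p k`. For `u` uniform on `[0,1]` the result has law `p`
(the default value matters only for `u = 1`). -/
def draw {K : ℕ} [NeZero K] (p : PMF (Fin K)) (u : unitInterval) : Fin K :=
  open Classical in
  if hne : (Finset.univ.filter fun k => (u : ℝ) < ∑ j ∈ Finset.Iic k, (p j).toReal).Nonempty then
    (Finset.univ.filter fun k => (u : ℝ) < ∑ j ∈ Finset.Iic k, (p j).toReal).min' hne
  else 0

/-- A sample point: the table of rewards, `ω.1 (k, s)` being the reward of the `(s+1)`-th pull of
arm `k`, and the seeds, `ω.2 t` being used to randomize the decision of round `t + 1`. -/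
abbrev Sample (K : ℕ) : Type := (Fin K × ℕ → unitInterval) × (ℕ → unitInterval)

/-- The law under `θ`: all rewards and seeds are independent, the rewards of arm `k` are
distributed as `θ k`, and the seeds are uniform on `[0,1]`. -/
def law {K : ℕ} (θ : Env K) : Measure (Sample K) :=
  (Measure.infinitePi fun i : Fin K × ℕ => (θ i.1 : Measure unitInterval)).prod
    (Measure.infinitePi fun _ : ℕ => (volume : Measure unitInterval))

/-- The history of the first `t` rounds when the policy `σ` is played. -/
def run {K : ℕ} [NeZero K] (σ : Policy K) (ω : Sample K) : ∀ t : ℕ, History K t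
  | 0 => Fin.elim0
  | t + 1 =>
    let h : History K t := run σ ω t
    let k : Fin K := draw (σ.choice t h) (ω.2 t)
    Fin.snoc (α := fun _ => Fin K × unitInterval) h (k, ω.1 (k, pulls h k))

/-- The mean reward of arm `k`. -/
def mean {K : ℕ} (θ : Env K) (k : Fin K) : ℝ :=
  ∫ x : unitInterval, (x : ℝ) ∂(θ k : Measure unitInterval)

/-- A fixed arm with maximal mean reward. -/
def bestArm {K : ℕ} [NeZero K] (θ : Env K) : Fin K :=
  (Finite.exists_max (mean θ)).choose

/-- The optimality gap of arm `k`. -/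
def gap {K : ℕ} [NeZero K] (θ : Env K) (k : Fin K) : ℝ :=
  mean θ (bestArm θ) - mean θ k

/-- The regret after `n` rounds: the sum of the first `n` rewards of the best arm minus the sum of
the rewards received by the policy. -/
def regret {K : ℕ} [NeZero K] (σ : Policy K) (θ : Env K) (n : ℕ) (ω : Sample K) : ℝ :=
  ∑ t ∈ Finset.range n, (ω.1 (bestArm θ, t) : ℝ) - ∑ i : Fin n, ((run σ ω n i).2 : ℝ)

/-- The expected regret after `n` rounds. -/
def expRegret {K : ℕ} [NeZero K] (σ : Policy K) (θ : Env K) (n : ℕ) : ℝ :=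
  ∫ ω, regret σ θ n ω ∂(law θ)

/-- `σ` is `α`-consistent on the set of environments `Θ`. -/
def IsConsistent {K : ℕ} [NeZero K] (α : ℝ) (Θ : Set (Env K)) (σ : Policy K) : Prop :=
  ∀ a > α, ∀ θ ∈ Θ, (fun n : ℕ => expRegret σ θ n) =o[atTop] fun n : ℕ => (n : ℝ) ^ a

end

end Bandit

/-!
The decision to draw an arm is independent of the reward it then reveals, so the expected regret is
the sum over the arms of the gap times the expected number of pulls.

*Upper bound.* Once an arm with gap `Δ` has been pulled `4 ρ log n / Δ²` times, its exploration
bonus is at most `Δ / 2`. From then on it is drawn at round `t` only if a mean of `s ≤ t` rewards of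
this arm or of the best one is off by its bonus `√(ρ log t / s)`. Cutting `[1, t]` into the
geometric cells `[β ^ (j + 1) t, β ^ j t]` and applying Doob's maximal inequality to the exponential
submartingale on each of them bounds the probability of such a deviation by a multiple of
`t ^ (-2ρβ) log t`, which sums over `t ≤ n` to the order of `n ^ (1 - 2ρβ) log n`.

*Lower bound.* Let arm `0` toss a fair coin and the other arms always pay `c = 1 / 2 - δ²`. If the
first `s ≈ ρ log n / δ²` tosses average `1 / 2 - δ - 2δ²`, the index of the coin stays below `c`
until round `n` after these tosses, and the regret is at least `δ² (n - s)`. By the entropy bound on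
binomial coefficients this happens with probability at least `exp (-s E) / (s + 1)`, where
`E = log 2 - H (1 / 2 - δ - 3δ²) = (2 + o(1)) δ²` as `δ → 0`, that is, with probability
`n ^ (-2ρ - o(1))`.
-/

section Resampling

theorem measurePreserving_update_infinitePi {ι : Type*} [DecidableEq ι] {X : ι → Type*}
    [∀ i, MeasurableSpace (X i)] (μ : ∀ i, Measure (X i)) [∀ i, IsProbabilityMeasure (μ i)]
    (i : ι) :
    MeasurePreserving (fun q : (∀ j, X j) × X i => Function.update q.1 i q.2)
      ((Measure.infinitePi μ).prod (μ i)) (Measure.infinitePi μ) := by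
  refine ⟨measurable_update', Measure.eq_infinitePi _ fun s t ht => ?_⟩
  rw [Measure.map_apply measurable_update' (MeasurableSet.pi s.countable_toSet fun j _ => ht j)]
  by_cases hi : i ∈ s
  · have hpre : (fun q : (∀ j, X j) × X i => Function.update q.1 i q.2) ⁻¹' Set.pi s t =
        Set.pi (s.erase i : Finset ι) t ×ˢ t i := by
      ext q
      rw [Set.mem_preimage, Set.update_mem_pi_iff, Set.mem_prod, Finset.coe_erase]
      simp [hi]
    rw [hpre, Measure.prod_prod, Measure.infinitePi_pi _ fun j _ => ht j,
      Finset.prod_erase_mul _ _ hi]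
  · have hpre : (fun q : (∀ j, X j) × X i => Function.update q.1 i q.2) ⁻¹' Set.pi s t =
        Set.pi s t ×ˢ Set.univ := by
      ext q
      rw [Set.mem_preimage, Set.update_mem_pi_iff, Set.mem_prod]
      simp [hi]
    rw [hpre, Measure.prod_prod, Measure.infinitePi_pi _ fun j _ => ht j, measure_univ, mul_one]

variable {Ω X : Type*} [MeasurableSpace Ω] [MeasurableSpace X]

theorem setIntegral_eq_measureReal_mul_integral_of_resample {P : Measure Ω} [SFinite P]
    {ν : Measure X} [IsProbabilityMeasure ν] {T : Ω × X → Ω}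
    (hT : MeasurePreserving T (P.prod ν) P) {A : Set Ω} (hA : MeasurableSet A)
    (hTA : T ⁻¹' A = A ×ˢ Set.univ) {f : Ω → ℝ} (hf : AEStronglyMeasurable f P) {g : X → ℝ}
    (hfg : ∀ q, f (T q) = g q.2) :
    ∫ ω in A, f ω ∂P = P.real A * ∫ x, g x ∂ν := by
  calc ∫ ω in A, f ω ∂P
      = ∫ q in T ⁻¹' A, f (T q) ∂P.prod ν := by
        conv_lhs => rw [← hT.map_eq]
        exact setIntegral_map hA (hT.map_eq.symm ▸ hf) hT.aemeasurable
    _ = ∫ q, g q.2 ∂(P.restrict A).prod ν := by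
        simp only [hfg, hTA, ← Measure.prod_restrict, Measure.restrict_univ]
    _ = P.real A * ∫ x, g x ∂ν := by
        rw [integral_fun_snd, measureReal_restrict_apply_univ, smul_eq_mul]

theorem integral_eq_of_forall_setIntegral_fiber_eq {ι : Type*} [Countable ι] [MeasurableSpace ι]
    [MeasurableSingletonClass ι] {P : Measure Ω} {e : Ω → ι} (he : Measurable e) {f g : Ω → ℝ}
    (hf : Integrable f P) (hg : Integrable g P)
    (h : ∀ i, ∫ ω in e ⁻¹' {i}, f ω ∂P = ∫ ω in e ⁻¹' {i}, g ω ∂P) :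
    ∫ ω, f ω ∂P = ∫ ω, g ω ∂P := by
  have hcover : ⋃ i, e ⁻¹' {i} = Set.univ := by
    rw [← Set.preimage_iUnion, Set.iUnion_of_singleton, Set.preimage_univ]
  have hmeas : ∀ i, MeasurableSet (e ⁻¹' {i}) := fun i => he (measurableSet_singleton i)
  have hdisj : Pairwise (Function.onFun Disjoint fun i => e ⁻¹' {i}) := fun i j hij =>
    (Set.disjoint_singleton.2 hij).preimage e
  rw [← setIntegral_univ, ← setIntegral_univ (f := g), ← hcover,
    integral_iUnion hmeas hdisj hf.integrableOn, integral_iUnion hmeas hdisj hg.integrableOn]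
  exact tsum_congr h

end Resampling

section MaximalInequality

open ProbabilityTheory

variable {Ω : Type*} [MeasurableSpace Ω] {P : Measure Ω}

theorem one_le_mgf_of_integral_eq_zero [IsProbabilityMeasure P] {X : Ω → ℝ} {l : ℝ}
    (hX : Integrable X P) (hexp : Integrable (fun ω => Real.exp (l * X ω)) P)
    (hmean : ∫ ω, X ω ∂P = 0) : 1 ≤ mgf X P l := by
  calc (1 : ℝ) = ∫ ω, (l * X ω + 1) ∂P := by
        rw [integral_add (hX.const_mul l) (integrable_const _), integral_const_mul, hmean,
          mul_zero, zero_add, integral_const, probReal_univ, one_smul]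
    _ ≤ mgf X P l := integral_mono ((hX.const_mul l).add (integrable_const _)) hexp
        fun ω => Real.add_one_le_exp _

variable {Y : ℕ → Ω → ℝ}

theorem submartingale_exp_sum_range (hindep : iIndepFun Y P) (hmeas : ∀ i, Measurable (Y i))
    {l : ℝ} (hint : ∀ i, Integrable (Y i) P)
    (hexp : ∀ i, Integrable (fun ω => Real.exp (l * Y i ω)) P)
    (hmean : ∀ i, ∫ ω, Y i ω ∂P = 0) :
    Submartingale (fun n ω => Real.exp (l * ∑ i ∈ Finset.range (n + 1), Y i ω))
      (Filtration.natural Y fun i => (hmeas i).stronglyMeasurable) P := by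
  have := hindep.isProbabilityMeasure
  let F := Filtration.natural Y fun i => (hmeas i).stronglyMeasurable
  have hY : StronglyAdapted F Y :=
    Filtration.stronglyAdapted_natural fun i => (hmeas i).stronglyMeasurable
  have hadapted : StronglyAdapted F
      fun n ω => Real.exp (l * ∑ i ∈ Finset.range (n + 1), Y i ω) := fun n =>
    Real.continuous_exp.comp_stronglyMeasurable <| .const_mul
      (Finset.stronglyMeasurable_fun_sum _ fun i hi =>
        hY.stronglyMeasurable_le (Nat.lt_succ_iff.1 (Finset.mem_range.1 hi))) l
  have hexpsum : ∀ n, Integrable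
      (fun ω => Real.exp (l * ∑ i ∈ Finset.range (n + 1), Y i ω)) P := fun n => by
    simpa only [Finset.sum_apply] using hindep.integrable_exp_mul_sum hmeas fun i _ => hexp i
  refine submartingale_nat hadapted hexpsum fun n => ?_
  have hfactor : (fun ω => Real.exp (l * ∑ i ∈ Finset.range (n + 1 + 1), Y i ω)) =
      (fun ω => Real.exp (l * ∑ i ∈ Finset.range (n + 1), Y i ω)) *
        fun ω => Real.exp (l * Y (n + 1) ω) := by
    funext ω
    rw [Finset.sum_range_succ, mul_add, Real.exp_add, Pi.mul_apply]
  have hpull := condExp_mul_of_stronglyMeasurable_left (hadapted n)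
    (hfactor ▸ hexpsum (n + 1)) (hexp (n + 1))
  have hfresh : P[fun ω => Real.exp (l * Y (n + 1) ω) | F n] =ᵐ[P] fun _ => mgf (Y (n + 1)) P l :=
    condExp_indep_eq (hmeas (n + 1)).comap_le (F.le n)
      (Real.measurable_exp.comp ((comap_measurable _).const_mul l)).stronglyMeasurable
      (hindep.indep_comap_natural_of_lt (fun i => (hmeas i).stronglyMeasurable) n.lt_succ_self)
  rw [hfactor]
  filter_upwards [hpull, hfresh] with ω hω hω'
  rw [hω, Pi.mul_apply, hω']
  exact le_mul_of_one_le_right (Real.exp_pos _).le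
    (one_le_mgf_of_integral_eq_zero (hint _) (hexp _) (hmean _))

theorem measureReal_exists_le_submartingale_le [IsFiniteMeasure P]
    {F : Filtration ℕ ‹MeasurableSpace Ω›} {f : ℕ → Ω → ℝ} (hf : Submartingale f F P)
    (hnonneg : 0 ≤ f) {ε : ℝ} (hε : 0 < ε) (n : ℕ) :
    P.real {ω | ∃ k ≤ n, ε ≤ f k ω} ≤ (∫ ω, f n ω ∂P) / ε := by
  lift ε to NNReal using hε.le
  have hset : {ω | ∃ k ≤ n, (ε : ℝ) ≤ f k ω} =
      {ω | (ε : ℝ) ≤ (Finset.range (n + 1)).sup' Finset.nonempty_range_add_one fun k => f k ω} := by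
    ext ω
    simp [Finset.le_sup'_iff]
  have hmax := (maximal_ineq hf hnonneg (ε := ε) n).trans <| ENNReal.ofReal_le_ofReal <|
    setIntegral_le_integral (hf.integrable n) (ae_of_all _ (hnonneg n))
  rw [hset, le_div_iff₀' hε]
  have hint : 0 ≤ ∫ ω, f n ω ∂P := integral_nonneg fun ω => hnonneg n ω
  simpa [measureReal_def, ENNReal.toReal_ofReal hint] using
    ENNReal.toReal_mono ENNReal.ofReal_ne_top hmax

variable {c : NNReal}

theorem measureReal_exists_le_sum_range_le_exp_sub (hindep : iIndepFun Y P)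
    (hmeas : ∀ i, Measurable (Y i)) (hsub : ∀ i, HasSubgaussianMGF (Y i) c P)
    (hmean : ∀ i, ∫ ω, Y i ω ∂P = 0) {ε : ℝ} (hε : 0 < ε) {l : ℝ} (hl : 0 ≤ l) (m : ℕ) :
    P.real {ω | ∃ s ≤ m, ε ≤ ∑ i ∈ Finset.range s, Y i ω} ≤
      Real.exp (m * c * l ^ 2 / 2 - l * ε) := by
  have := hindep.isProbabilityMeasure
  cases m with
  | zero =>
    have hempty : {ω | ∃ s ≤ 0, ε ≤ ∑ i ∈ Finset.range s, Y i ω} = ∅ := by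
      ext ω
      simpa using hε
    rw [hempty, measureReal_empty]
    exact (Real.exp_pos _).le
  | succ m =>
    have hmgf : ∫ ω, Real.exp (l * ∑ i ∈ Finset.range (m + 1), Y i ω) ∂P ≤
        Real.exp ((m + 1 : ℕ) * c * l ^ 2 / 2) := by
      simpa [mgf] using (HasSubgaussianMGF.sum_of_iIndepFun hindep
        (fun i (_ : i ∈ Finset.range (m + 1)) => hsub i)).mgf_le l
    calc P.real {ω | ∃ s ≤ m + 1, ε ≤ ∑ i ∈ Finset.range s, Y i ω}
        ≤ P.real {ω | ∃ k ≤ m,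
            Real.exp (l * ε) ≤ Real.exp (l * ∑ i ∈ Finset.range (k + 1), Y i ω)} := by
          refine measureReal_mono ?_
          rintro ω ⟨_ | k, hk, hsum⟩
          · exact absurd hsum (by simpa using hε)
          · exact ⟨k, Nat.succ_le_succ_iff.1 hk,
              Real.exp_le_exp.2 (mul_le_mul_of_nonneg_left hsum hl)⟩
      _ ≤ (∫ ω, Real.exp (l * ∑ i ∈ Finset.range (m + 1), Y i ω) ∂P) / Real.exp (l * ε) :=
          measureReal_exists_le_submartingale_le
            (submartingale_exp_sum_range hindep hmeas (fun i => (hsub i).integrable)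
              (fun i => (hsub i).integrable_exp_mul l) hmean)
            (fun _ _ => (Real.exp_pos _).le) (Real.exp_pos _) m
      _ ≤ Real.exp ((m + 1 : ℕ) * c * l ^ 2 / 2) / Real.exp (l * ε) := by gcongr
      _ = Real.exp ((m + 1 : ℕ) * c * l ^ 2 / 2 - l * ε) := (Real.exp_sub _ _).symm

theorem measureReal_exists_le_sum_range_le_exp (hindep : iIndepFun Y P)
    (hmeas : ∀ i, Measurable (Y i)) (hsub : ∀ i, HasSubgaussianMGF (Y i) c P)
    (hmean : ∀ i, ∫ ω, Y i ω ∂P = 0) (hc : 0 < c) {ε M : ℝ} (hε : 0 < ε) (hM : 0 < M) :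
    P.real {ω | ∃ s : ℕ, s ≤ M ∧ ε ≤ ∑ i ∈ Finset.range s, Y i ω} ≤
      Real.exp (-(ε ^ 2 / (2 * M * c))) := by
  have : (0 : ℝ) < c := hc
  simp only [← Nat.le_floor_iff hM.le]
  calc P.real {ω | ∃ s ≤ ⌊M⌋₊, ε ≤ ∑ i ∈ Finset.range s, Y i ω}
      ≤ Real.exp (⌊M⌋₊ * c * (ε / (M * c)) ^ 2 / 2 - ε / (M * c) * ε) :=
        measureReal_exists_le_sum_range_le_exp_sub hindep hmeas hsub hmean hε (by positivity) _
    _ ≤ Real.exp (M * c * (ε / (M * c)) ^ 2 / 2 - ε / (M * c) * ε) := by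
        gcongr
        exact Nat.floor_le hM.le
    _ = Real.exp (-(ε ^ 2 / (2 * M * c))) := by
        congr 1
        field_simp
        ring

theorem exists_le_floor_log_pow_near {β : ℝ} (hβ : β ∈ Set.Ioo 0 1) {s t : ℕ} (hs : 1 ≤ s)
    (hst : s ≤ t) :
    ∃ j ≤ ⌊Real.log t / Real.log (1 / β)⌋₊, β ^ (j + 1) * t ≤ s ∧ s ≤ β ^ j * t := by
  have hs' : (1 : ℝ) ≤ s := Nat.one_le_cast.2 hs
  have ht : (0 : ℝ) < t := by exact_mod_cast hs.trans hst
  obtain ⟨j, hlower, hupper⟩ := exists_nat_pow_near_of_lt_one (x := (s : ℝ) / t) (y := β)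
    (by positivity) ((div_le_one ht).2 (Nat.cast_le.2 hst)) hβ.1 hβ.2
  rw [lt_div_iff₀ ht] at hlower
  rw [div_le_iff₀ ht] at hupper
  refine ⟨j, ?_, hlower.le, hupper⟩
  have hlog : 0 < Real.log (1 / β) := Real.log_pos (one_lt_one_div hβ.1 hβ.2)
  have hcell := Real.log_nonneg (hs'.trans hupper)
  rw [Real.log_mul (pow_pos hβ.1 j).ne' ht.ne', Real.log_pow] at hcell
  rw [Nat.le_floor_iff (div_nonneg (Real.log_natCast_nonneg t) hlog.le), le_div_iff₀ hlog,
    one_div, Real.log_inv]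
  linarith

theorem exists_sqrt_le_of_sqrt_div_le {x S β : ℝ} (hx : 0 ≤ x) (hβ : β ∈ Set.Ioo 0 1) {s t : ℕ}
    (hs : 1 ≤ s) (hst : s ≤ t) (h : √(x / s) ≤ S / s) :
    ∃ j ≤ ⌊Real.log t / Real.log (1 / β)⌋₊, s ≤ β ^ j * t ∧ √(x * (β ^ (j + 1) * t)) ≤ S := by
  have hs' : (0 : ℝ) < s := Nat.cast_pos.2 hs
  obtain ⟨j, hj, hlower, hupper⟩ := exists_le_floor_log_pow_near hβ hs hst
  refine ⟨j, hj, hupper, ?_⟩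
  calc √(x * (β ^ (j + 1) * t)) ≤ √(x * s) := by gcongr
    _ = √(x / s * s ^ 2) := by
        congr 1
        field_simp
    _ = √(x / s) * s := by rw [Real.sqrt_mul (by positivity), Real.sqrt_sq hs'.le]
    _ ≤ S := (le_div_iff₀ hs').1 h

theorem measureReal_exists_sqrt_div_le_average_le (hindep : iIndepFun Y P)
    (hmeas : ∀ i, Measurable (Y i)) (hsub : ∀ i, HasSubgaussianMGF (Y i) c P)
    (hmean : ∀ i, ∫ ω, Y i ω ∂P = 0) (hc : 0 < c) {x β : ℝ} (hx : 0 < x)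
    (hβ : β ∈ Set.Ioo 0 1) {t : ℕ} (ht : 1 ≤ t) :
    P.real {ω | ∃ s ∈ Finset.Icc 1 t, √(x / s) ≤ (∑ i ∈ Finset.range s, Y i ω) / s} ≤
      (Real.log t / Real.log (1 / β) + 1) * Real.exp (-(β * x / (2 * c))) := by
  have := hindep.isProbabilityMeasure
  have hβ0 : 0 < β := hβ.1
  have : (0 : ℝ) < c := hc
  have : (0 : ℝ) < t := Nat.cast_pos.2 ht
  set N := ⌊Real.log t / Real.log (1 / β)⌋₊
  let cell (j : ℕ) : Set Ω :=
    {ω | ∃ s : ℕ, s ≤ β ^ j * t ∧ √(x * (β ^ (j + 1) * t)) ≤ ∑ i ∈ Finset.range s, Y i ω}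
  have hcell : ∀ j, P.real (cell j) ≤ Real.exp (-(β * x / (2 * c))) := fun j => by
    refine (measureReal_exists_le_sum_range_le_exp hindep hmeas hsub hmean hc
      (Real.sqrt_pos.2 (by positivity)) (by positivity)).trans_eq ?_
    rw [Real.sq_sqrt (by positivity)]
    congr 2
    field_simp
    ring
  have hcover : {ω | ∃ s ∈ Finset.Icc 1 t, √(x / s) ≤ (∑ i ∈ Finset.range s, Y i ω) / s} ⊆
      ⋃ j ∈ Finset.range (N + 1), cell j := by
    rintro ω ⟨s, hs, hdev⟩
    obtain ⟨hs1, hst⟩ := Finset.mem_Icc.1 hs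
    obtain ⟨j, hj, hle, hsqrt⟩ := exists_sqrt_le_of_sqrt_div_le hx.le hβ hs1 hst hdev
    exact Set.mem_biUnion (Finset.mem_coe.2 (Finset.mem_range_succ_iff.2 hj)) ⟨s, hle, hsqrt⟩
  have hlog : 0 < Real.log (1 / β) := Real.log_pos (one_lt_one_div hβ.1 hβ.2)
  calc P.real {ω | ∃ s ∈ Finset.Icc 1 t, √(x / s) ≤ (∑ i ∈ Finset.range s, Y i ω) / s}
      ≤ P.real (⋃ j ∈ Finset.range (N + 1), cell j) :=
        measureReal_mono hcover (measure_ne_top _ _)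
    _ ≤ ∑ j ∈ Finset.range (N + 1), P.real (cell j) := measureReal_biUnion_finset_le _ _
    _ ≤ (N + 1) * Real.exp (-(β * x / (2 * c))) := by
        simpa using Finset.sum_le_card_nsmul (Finset.range (N + 1)) _ _ fun j _ => hcell j
    _ ≤ (Real.log t / Real.log (1 / β) + 1) * Real.exp (-(β * x / (2 * c))) := by
        gcongr
        exact Nat.floor_le (div_nonneg (Real.log_natCast_nonneg t) hlog.le)

theorem measureReal_exists_sqrt_mul_log_div_le_average_le (hindep : iIndepFun Y P)
    (hmeas : ∀ i, Measurable (Y i)) (hsub : ∀ i, HasSubgaussianMGF (Y i) c P)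
    (hmean : ∀ i, ∫ ω, Y i ω ∂P = 0) (hc : 0 < c) {ρ β : ℝ} (hρ : 0 < ρ)
    (hβ : β ∈ Set.Ioo 0 1) {t : ℕ} (ht : 2 ≤ t) :
    P.real {ω | ∃ s ∈ Finset.Icc 1 t,
        √(ρ * Real.log t / s) ≤ (∑ i ∈ Finset.range s, Y i ω) / s} ≤
      (Real.log t / Real.log (1 / β) + 1) * (t : ℝ) ^ (-(β * ρ / (2 * c))) := by
  have hlog : 0 < Real.log t := Real.log_pos (Nat.one_lt_cast.2 ht)
  refine (measureReal_exists_sqrt_div_le_average_le hindep hmeas hsub hmean hc (mul_pos hρ hlog)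
    hβ (one_le_two.trans ht)).trans_eq ?_
  rw [Real.rpow_def_of_pos (by positivity)]
  congr 2
  ring

end MaximalInequality

section RealEstimates

theorem sqrt_div_le_half {x y s Δ : ℝ} (hxy : x ≤ y) (hs : 0 < s) (hΔ : 0 < Δ)
    (h : 4 * y / Δ ^ 2 ≤ s) : √(x / s) ≤ Δ / 2 := by
  refine Real.sqrt_le_iff.2 ⟨by positivity, ?_⟩
  rw [div_le_iff₀ (by positivity)] at h
  rw [div_le_iff₀ hs]
  linarith

theorem sum_Ico_rpow_neg_le {a : ℝ} (ha0 : 0 ≤ a) (ha1 : a < 1) {n : ℕ} (hn : 1 ≤ n) :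
    ∑ t ∈ Finset.Ico 1 n, ((t : ℝ) + 1) ^ (-a) ≤ ((n : ℝ) ^ (1 - a) - 1) / (1 - a) := by
  have hanti : AntitoneOn (fun x : ℝ => x ^ (-a)) (Set.Icc (1 : ℕ) n) := fun x hx y _ hxy =>
    Real.rpow_le_rpow_of_nonpos (one_pos.trans_le (by simpa using hx.1)) hxy (neg_nonpos.2 ha0)
  have hle := hanti.sum_le_integral_Ico hn
  rw [integral_rpow (Or.inl (by linarith)), neg_add_eq_sub] at hle
  simpa using hle

theorem isLittleO_log_mul_rpow_natCast {b a : ℝ} (hba : b < a) :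
    (fun n : ℕ => Real.log n * (n : ℝ) ^ b) =o[atTop] fun n : ℕ => (n : ℝ) ^ a := by
  have hlog : (fun n : ℕ => Real.log n) =o[atTop] fun n : ℕ => (n : ℝ) ^ (a - b) :=
    (isLittleO_log_rpow_atTop (sub_pos.2 hba)).comp_tendsto tendsto_natCast_atTop_atTop
  refine (hlog.mul_isBigO (isBigO_refl _ _)).congr' EventuallyEq.rfl ?_
  filter_upwards [eventually_gt_atTop 0] with n hn
  rw [← Real.rpow_add (Nat.cast_pos.2 hn), sub_add_cancel]

theorem isLittleO_rpow_natCast {b a : ℝ} (hba : b < a) :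
    (fun n : ℕ => (n : ℝ) ^ b) =o[atTop] fun n : ℕ => (n : ℝ) ^ a := by
  refine IsBigO.trans_isLittleO (IsBigO.of_bound 1 ?_) (isLittleO_log_mul_rpow_natCast hba)
  have hlog := Real.tendsto_log_atTop.comp tendsto_natCast_atTop_atTop
  filter_upwards [hlog.eventually_ge_atTop 1] with n hn
  rw [one_mul, norm_mul]
  exact le_mul_of_one_le_left (norm_nonneg _) (hn.trans (le_abs_self _))

theorem tendsto_rpow_div_mul_log_add_atTop {r C : ℝ} (hr : 0 < r) (hC : 0 < C) (D : ℝ) :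
    Tendsto (fun n : ℕ => (n : ℝ) ^ r / (C * Real.log n + D)) atTop atTop := by
  have hpow : Tendsto (fun n : ℕ => (n : ℝ) ^ r) atTop atTop :=
    (tendsto_rpow_atTop hr).comp tendsto_natCast_atTop_atTop
  have hlog : Tendsto (fun n : ℕ => C * Real.log n + D) atTop atTop :=
    tendsto_atTop_add_const_right _ _
      ((Real.tendsto_log_atTop.comp tendsto_natCast_atTop_atTop).const_mul_atTop hC)
  have hlittle : (fun n : ℕ => C * Real.log n + D) =o[atTop] fun n : ℕ => (n : ℝ) ^ r :=
    (((isLittleO_log_rpow_atTop hr).comp_tendsto tendsto_natCast_atTop_atTop).const_mul_left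
      C).add (isLittleO_const_left.2 (Or.inr (tendsto_norm_atTop_atTop.comp hpow)))
  have hpos : ∀ᶠ n : ℕ in atTop, 0 < (C * Real.log n + D) / (n : ℝ) ^ r := by
    filter_upwards [hpow.eventually_gt_atTop 0, hlog.eventually_gt_atTop 0] with n hn hn'
    exact div_pos hn' hn
  refine ((tendsto_nhdsWithin_iff.2
    ⟨hlittle.tendsto_div_nhds_zero, hpos⟩).inv_tendsto_nhdsGT_zero).congr fun n => ?_
  rw [Pi.inv_apply, inv_div]

theorem rpow_neg_mul_mul_exp_neg_le_exp_neg_ceil_mul {C E : ℝ} (hC : 0 ≤ C) (hE : 0 ≤ E) {n : ℕ}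
    (hn : 0 < n) :
    (n : ℝ) ^ (-(C * E)) * Real.exp (-E) ≤ Real.exp (-(⌈C * Real.log n⌉₊ * E)) := by
  rw [Real.rpow_def_of_pos (Nat.cast_pos.2 hn), ← Real.exp_add, Real.exp_le_exp]
  have hceil := Nat.ceil_lt_add_one (mul_nonneg hC (Real.log_natCast_nonneg n))
  linarith [mul_le_mul_of_nonneg_right hceil.le hE]

theorem tendsto_sub_ceil_log_mul_exp_div_rpow_atTop {C E r : ℝ} (hC : 0 < C) (hE : 0 ≤ E)
    (hr : r < 1 - C * E) :
    Tendsto (fun n : ℕ => ((n : ℝ) - ⌈C * Real.log n⌉₊) *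
      (Real.exp (-(⌈C * Real.log n⌉₊ * E)) / (⌈C * Real.log n⌉₊ + 1)) / (n : ℝ) ^ r)
      atTop atTop := by
  have hlim := (tendsto_rpow_div_mul_log_add_atTop (sub_pos.2 hr) hC 2).const_mul_atTop
    (by positivity : 0 < Real.exp (-E) / 2)
  refine tendsto_atTop_mono' _ ?_ hlim
  filter_upwards [eventually_gt_atTop 0,
    (tendsto_rpow_div_mul_log_add_atTop one_pos hC 1).eventually_ge_atTop 2] with n hn hlog
  have hn' : (0 : ℝ) < n := Nat.cast_pos.2 hn
  have hClog : 0 ≤ C * Real.log n := mul_nonneg hC.le (Real.log_natCast_nonneg n)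
  have hceil : (⌈C * Real.log n⌉₊ : ℝ) + 1 ≤ C * Real.log n + 2 := by
    linarith [Nat.ceil_lt_add_one hClog]
  have hhalf : (n : ℝ) / 2 ≤ n - ⌈C * Real.log n⌉₊ := by
    rw [Real.rpow_one, le_div_iff₀ (by positivity)] at hlog
    linarith
  have hsub : (0 : ℝ) ≤ n - ⌈C * Real.log n⌉₊ := (half_pos hn').le.trans hhalf
  calc Real.exp (-E) / 2 * ((n : ℝ) ^ (1 - C * E - r) / (C * Real.log n + 2))
      = n / 2 * ((n : ℝ) ^ (-(C * E)) * Real.exp (-E) / (C * Real.log n + 2)) / (n : ℝ) ^ r := by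
        rw [Real.rpow_sub hn', sub_eq_add_neg, Real.rpow_add hn', Real.rpow_one]
        ring
    _ ≤ _ := by
        gcongr
        exact rpow_neg_mul_mul_exp_neg_le_exp_neg_ceil_mul hC.le hE hn

end RealEstimates

section Binomial

open ProbabilityTheory

theorem factorial_mul_pow_le_factorial_mul_pow (m j : ℕ) :
    m.factorial * m ^ j ≤ j.factorial * m ^ m := by
  rcases le_total m j with h | h
  · calc m.factorial * m ^ j = m.factorial * m ^ (j - m) * m ^ m := by
          rw [mul_assoc, ← pow_add, Nat.sub_add_cancel h]
      _ ≤ j.factorial * m ^ m := by gcongr; exact Nat.factorial_mul_pow_sub_le_factorial h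
  · calc m.factorial * m ^ j = j.factorial * m.descFactorial (m - j) * m ^ j := by
          rw [← Nat.factorial_mul_descFactorial (Nat.sub_le m j), Nat.sub_sub_self h]
      _ ≤ j.factorial * m ^ (m - j) * m ^ j := by gcongr; exact Nat.descFactorial_le_pow _ _
      _ = j.factorial * m ^ m := by rw [mul_assoc, ← pow_add, Nat.sub_add_cancel h]

theorem pow_mul_pow_mul_choose_le {s m j : ℕ} (hm : m ≤ s) (hj : j ≤ s) :
    m ^ j * (s - m) ^ (s - j) * s.choose j ≤ m ^ m * (s - m) ^ (s - m) * s.choose m := by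
  refine Nat.le_of_mul_le_mul_right ?_ (Nat.mul_pos (m.factorial_pos) ((s - m).factorial_pos))
  refine Nat.le_of_mul_le_mul_right ?_ (Nat.mul_pos (j.factorial_pos) ((s - j).factorial_pos))
  calc m ^ j * (s - m) ^ (s - j) * s.choose j * (m.factorial * (s - m).factorial) *
        (j.factorial * (s - j).factorial)
      = (m.factorial * m ^ j) * ((s - m).factorial * (s - m) ^ (s - j)) *
          (s.choose j * j.factorial * (s - j).factorial) := by ring
    _ ≤ (j.factorial * m ^ m) * ((s - j).factorial * (s - m) ^ (s - m)) *
          (s.choose j * j.factorial * (s - j).factorial) := by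
        gcongr ?_ * ?_ * _ <;> exact factorial_mul_pow_le_factorial_mul_pow _ _
    _ = (j.factorial * m ^ m) * ((s - j).factorial * (s - m) ^ (s - m)) *
          (s.choose m * m.factorial * (s - m).factorial) := by
        rw [Nat.choose_mul_factorial_mul_factorial hm, Nat.choose_mul_factorial_mul_factorial hj]
    _ = m ^ m * (s - m) ^ (s - m) * s.choose m * (m.factorial * (s - m).factorial) *
          (j.factorial * (s - j).factorial) := by ring

-- The mode of a binomial distribution carries at least the average mass.
theorem pow_self_le_succ_mul_choose {s m : ℕ} (hm : m ≤ s) :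
    s ^ s ≤ (s + 1) * (m ^ m * (s - m) ^ (s - m) * s.choose m) := by
  calc s ^ s = (m + (s - m)) ^ s := by rw [Nat.add_sub_cancel' hm]
    _ = ∑ j ∈ Finset.range (s + 1), m ^ j * (s - m) ^ (s - j) * s.choose j := add_pow _ _ _
    _ ≤ ∑ _j ∈ Finset.range (s + 1), m ^ m * (s - m) ^ (s - m) * s.choose m :=
        Finset.sum_le_sum fun j hj =>
          pow_mul_pow_mul_choose_le hm (Nat.lt_succ_iff.1 (Finset.mem_range.1 hj))
    _ = (s + 1) * (m ^ m * (s - m) ^ (s - m) * s.choose m) := by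
        rw [Finset.sum_const, Finset.card_range, smul_eq_mul]

theorem pow_mul_one_sub_pow_le_exp_neg_binEntropy {s m : ℕ} (hs : 0 < s) (hm : m ≤ s) :
    ((m : ℝ) / s) ^ m * (1 - m / s) ^ (s - m) ≤ Real.exp (-(s * Real.binEntropy (m / s))) := by
  have hs' : (0 : ℝ) < s := Nat.cast_pos.2 hs
  have hp : (m : ℝ) / s ≤ 1 := (div_le_one hs').2 (Nat.cast_le.2 hm)
  calc ((m : ℝ) / s) ^ m * (1 - m / s) ^ (s - m)
      ≤ Real.exp (Real.log (m / s)) ^ m * Real.exp (Real.log (1 - m / s)) ^ (s - m) := by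
        have : (0 : ℝ) ≤ 1 - m / s := sub_nonneg.2 hp
        gcongr <;> exact Real.le_exp_log _
    _ = Real.exp (-(s * Real.binEntropy (m / s))) := by
        rw [← Real.exp_nat_mul, ← Real.exp_nat_mul, ← Real.exp_add, Nat.cast_sub hm,
          Real.binEntropy, Real.log_inv, Real.log_inv]
        congr 1
        field_simp
        ring

theorem exp_mul_binEntropy_le_succ_mul_choose {s m : ℕ} (hs : 0 < s) (hm : m ≤ s) :
    Real.exp (s * Real.binEntropy (m / s)) ≤ (s + 1) * s.choose m := by
  have hs' : (0 : ℝ) < s := Nat.cast_pos.2 hs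
  have hcount : (s : ℝ) ^ s ≤ (s + 1) * ((m : ℝ) ^ m * (s - m) ^ (s - m) * s.choose m) := by
    rw [← Nat.cast_sub hm]
    exact_mod_cast pow_self_le_succ_mul_choose hm
  have hscale : (m : ℝ) ^ m * (s - m) ^ (s - m) =
      s ^ s * ((m / s) ^ m * (1 - m / s) ^ (s - m)) := by
    have hpow : (s : ℝ) ^ s = s ^ m * s ^ (s - m) := by rw [← pow_add, Nat.add_sub_cancel' hm]
    rw [hpow, mul_mul_mul_comm, ← mul_pow, ← mul_pow, mul_sub, mul_div_cancel₀ _ hs'.ne', mul_one]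
  have hmode : 1 ≤ (s + 1) * s.choose m * Real.exp (-(s * Real.binEntropy (m / s))) := by
    refine le_of_mul_le_mul_left ?_ (pow_pos hs' s)
    calc (s : ℝ) ^ s * 1 = s ^ s := mul_one _
      _ ≤ s ^ s * ((s + 1) * s.choose m * ((m / s) ^ m * (1 - m / s) ^ (s - m))) := by
          rw [hscale] at hcount
          linarith
      _ ≤ s ^ s * ((s + 1) * s.choose m * Real.exp (-(s * Real.binEntropy (m / s)))) := by
          gcongr
          exact pow_mul_one_sub_pow_le_exp_neg_binEntropy hs hm
  rwa [Real.exp_neg, ← div_eq_mul_inv, le_div_iff₀ (Real.exp_pos _), one_mul] at hmode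

theorem exp_neg_mul_div_le_choose_div_two_pow {s m : ℕ} (hs : 0 < s) {p : ℝ} (hp : 0 ≤ p)
    (hpm : s * p ≤ m) (hm : 2 * m ≤ s) :
    Real.exp (-(s * (Real.log 2 - Real.binEntropy p))) / (s + 1) ≤ s.choose m / 2 ^ s := by
  have hs' : (0 : ℝ) < s := Nat.cast_pos.2 hs
  have hhalf : (m : ℝ) / s ≤ 2⁻¹ := by
    rw [div_le_iff₀ hs', inv_mul_eq_div, le_div_iff₀' two_pos]
    exact_mod_cast hm
  have hpm' : p ≤ m / s := (le_div_iff₀' hs').2 hpm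
  have hentropy : Real.binEntropy p ≤ Real.binEntropy (m / s) :=
    Real.binEntropy_strictMonoOn.monotoneOn ⟨hp, hpm'.trans hhalf⟩ ⟨hp.trans hpm', hhalf⟩ hpm'
  have hfactor : Real.exp (-(s * (Real.log 2 - Real.binEntropy p))) =
      Real.exp (s * Real.binEntropy p) / 2 ^ s := by
    rw [mul_sub, neg_sub, Real.exp_sub, Real.exp_nat_mul (Real.log 2), Real.exp_log two_pos]
  rw [hfactor, div_right_comm]
  gcongr
  rw [div_le_iff₀' (by positivity)]
  calc Real.exp (s * Real.binEntropy p) ≤ Real.exp (s * Real.binEntropy (m / s)) := by gcongr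
    _ ≤ (s + 1) * s.choose m := exp_mul_binEntropy_le_succ_mul_choose hs (by omega)

theorem mul_log_add_mul_log_le {z : ℝ} (hz0 : 0 ≤ z) (hz1 : z ≤ 1 / 2) :
    (1 - z) * Real.log (1 - z) + (1 + z) * Real.log (1 + z) ≤ z ^ 2 + 4 * z ^ 3 := by
  have hremainder : |z| ^ 3 / (1 - |z|) ≤ 2 * z ^ 3 := by
    rw [abs_of_nonneg hz0, div_le_iff₀ (by linarith)]
    nlinarith [mul_nonneg (pow_nonneg hz0 3) (sub_nonneg.2 hz1)]
  have htaylor : ∀ x : ℝ, |x| = |z| → Real.log (1 - x) ≤ -x - x ^ 2 / 2 + 2 * z ^ 3 := by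
    intro x hx
    have h := (le_abs_self _).trans (Real.abs_log_sub_add_sum_range_le
      (by rw [hx, abs_of_nonneg hz0]; linarith) 2)
    rw [hx] at h
    norm_num [Finset.sum_range_succ] at h
    linarith
  have hminus := mul_le_mul_of_nonneg_left (htaylor z rfl) (by linarith : 0 ≤ 1 - z)
  have hplus := mul_le_mul_of_nonneg_left (htaylor (-z) (abs_neg z)) (by linarith : 0 ≤ 1 + z)
  rw [sub_neg_eq_add] at hplus
  nlinarith

theorem log_two_sub_binEntropy_half_sub_le {y : ℝ} (hy0 : 0 ≤ y) (hy1 : y ≤ 1 / 4) :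
    Real.log 2 - Real.binEntropy (1 / 2 - y) ≤ 2 * y ^ 2 + 16 * y ^ 3 := by
  have hlog : ∀ x : ℝ, 0 < x → Real.log (x / 2)⁻¹ = Real.log 2 - Real.log x := fun x hx => by
    rw [inv_div, Real.log_div two_ne_zero hx.ne']
  have hminus : (1 / 2 - y : ℝ) = (1 - 2 * y) / 2 := by ring
  have hplus : (1 - (1 / 2 - y) : ℝ) = (1 + 2 * y) / 2 := by ring
  rw [Real.binEntropy, hplus, hminus, hlog _ (by linarith), hlog _ (by linarith)]
  have h := mul_log_add_mul_log_le (z := 2 * y) (by linarith) (by linarith)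
  linarith

section Tosses

variable {Ω : Type*} {mΩ : MeasurableSpace Ω} {P : Measure Ω} {Y : ℕ → Ω → ℝ} {p q : ℝ}

theorem measureReal_sum_range_eq_inter_eq (hindep : iIndepFun Y P) (hmeas : ∀ i, Measurable (Y i))
    (s : ℕ) (x y : ℝ) :
    P.real ({ω | ∑ i ∈ Finset.range s, Y i ω = x} ∩ {ω | Y s ω = y}) =
      P.real {ω | ∑ i ∈ Finset.range s, Y i ω = x} * P.real {ω | Y s ω = y} := by
  have h := (hindep.indepFun_finsetSum_of_notMem hmeas
    (Finset.notMem_range_self (n := s))).measure_inter_preimage_eq_mul _ _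
      (measurableSet_singleton x) (measurableSet_singleton y)
  simpa only [Measure.real, Set.preimage, Finset.sum_apply, Set.mem_singleton_iff,
    ENNReal.toReal_mul] using congrArg ENNReal.toReal h

theorem mul_add_mul_le_measureReal_sum_range_succ_eq (hindep : iIndepFun Y P)
    (hmeas : ∀ i, Measurable (Y i)) (s : ℕ) (x : ℝ) :
    P.real {ω | ∑ i ∈ Finset.range s, Y i ω = x} * P.real {ω | Y s ω = 1} +
        P.real {ω | ∑ i ∈ Finset.range s, Y i ω = x + 1} * P.real {ω | Y s ω = 0} ≤
      P.real {ω | ∑ i ∈ Finset.range (s + 1), Y i ω = x + 1} := by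
  have := hindep.isProbabilityMeasure
  rw [← measureReal_sum_range_eq_inter_eq hindep hmeas,
    ← measureReal_sum_range_eq_inter_eq hindep hmeas, ← measureReal_union]
  · refine measureReal_mono ?_
    rintro ω (⟨hsum, hlast⟩ | ⟨hsum, hlast⟩) <;>
      simp_all [Finset.sum_range_succ]
  · refine Set.disjoint_left.2 fun ω hω hω' => ?_
    exact one_ne_zero (hω.2.symm.trans hω'.2)
  · exact ((Finset.measurable_sum _ fun i _ => hmeas i) (measurableSet_singleton _)).inter
      (hmeas s (measurableSet_singleton _))

theorem choose_mul_pow_mul_pow_le_measureReal_sum_range_eq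
    (hindep : iIndepFun Y P) (hmeas : ∀ i, Measurable (Y i))
    (hone : ∀ i, P.real {ω | Y i ω = 1} = p) (hzero : ∀ i, P.real {ω | Y i ω = 0} = q)
    (s m : ℕ) :
    s.choose m * p ^ m * q ^ (s - m) ≤ P.real {ω | ∑ i ∈ Finset.range s, Y i ω = m} := by
  have := hindep.isProbabilityMeasure
  have hp : 0 ≤ p := hone 0 ▸ measureReal_nonneg
  have hq : 0 ≤ q := hzero 0 ▸ measureReal_nonneg
  induction s generalizing m with
  | zero => cases m <;> simp
  | succ s ih =>
    cases m with
    | zero =>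
      have hstep := mul_add_mul_le_measureReal_sum_range_succ_eq hindep hmeas s (-1)
      have hprev := mul_le_mul_of_nonneg_right (ih 0) hq
      rw [hone, hzero, neg_add_cancel] at hstep
      simp only [Nat.choose_zero_right, Nat.cast_one, Nat.cast_zero, pow_zero, Nat.sub_zero,
        one_mul] at hprev ⊢
      rw [pow_succ]
      refine hprev.trans (le_trans ?_ hstep)
      exact le_add_of_nonneg_left (mul_nonneg measureReal_nonneg hp)
    | succ m =>
      have hstep := mul_add_mul_le_measureReal_sum_range_succ_eq hindep hmeas s m
      have htail : (s.choose (m + 1) : ℝ) * p ^ (m + 1) * q ^ (s - m) =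
          s.choose (m + 1) * p ^ (m + 1) * q ^ (s - (m + 1)) * q := by
        rcases lt_or_ge s (m + 1) with h | h
        · simp [Nat.choose_eq_zero_of_lt h]
        · rw [mul_assoc _ _ q, ← pow_succ, Nat.sub_add_eq, Nat.sub_add_cancel (by omega)]
      rw [hone, hzero] at hstep
      calc ((s + 1).choose (m + 1) : ℝ) * p ^ (m + 1) * q ^ (s + 1 - (m + 1))
          = s.choose m * p ^ m * q ^ (s - m) * p +
              s.choose (m + 1) * p ^ (m + 1) * q ^ (s - (m + 1)) * q := by
            rw [← htail, Nat.choose_succ_succ, Nat.add_sub_add_right]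
            push_cast
            ring
        _ ≤ P.real {ω | ∑ i ∈ Finset.range s, Y i ω = m} * p +
              P.real {ω | ∑ i ∈ Finset.range s, Y i ω = m + 1} * q := by
            gcongr
            · exact ih m
            · exact_mod_cast ih (m + 1)
        _ ≤ _ := by exact_mod_cast hstep

end Tosses

theorem exists_add_sqrt_lt_and_exp_div_le_choose_div_two_pow {δ x : ℝ} {s : ℕ} (hδ : 0 < δ)
    (hδ' : δ ≤ 1 / 8) (hs : 1 ≤ δ ^ 2 * s) (hx : x ≤ δ ^ 2 * s) :
    ∃ m : ℕ, m / s + √(x / s) < 1 / 2 - δ ^ 2 ∧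
      Real.exp (-(s * (Real.log 2 - Real.binEntropy (1 / 2 - (δ + 3 * δ ^ 2))))) / (s + 1) ≤
        s.choose m / 2 ^ s := by
  have hδ2 : 0 < δ ^ 2 := by positivity
  have hδ2' : δ ^ 2 ≤ 1 / 64 := by nlinarith
  have hs' : (0 : ℝ) < s := pos_of_mul_pos_right (one_pos.trans_le hs) hδ2.le
  have hsqrt : √(x / s) ≤ δ := Real.sqrt_le_iff.2 ⟨hδ.le, (div_le_iff₀ hs').2 hx⟩
  let v : ℝ := s * (1 / 2 - (δ + 2 * δ ^ 2))
  have hv : 0 ≤ v := mul_nonneg hs'.le (by linarith)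
  have hle : (⌊v⌋₊ : ℝ) ≤ v := Nat.floor_le hv
  have hge : s * (1 / 2 - (δ + 3 * δ ^ 2)) ≤ ⌊v⌋₊ :=
    calc s * (1 / 2 - (δ + 3 * δ ^ 2)) = v - δ ^ 2 * s := by ring
      _ ≤ v - 1 := by gcongr
      _ ≤ ⌊v⌋₊ := (Nat.sub_one_lt_floor v).le
  refine ⟨⌊v⌋₊, ?_, exp_neg_mul_div_le_choose_div_two_pow (Nat.cast_pos.1 hs') (by linarith) hge ?_⟩
  · have : (⌊v⌋₊ : ℝ) / s ≤ 1 / 2 - (δ + 2 * δ ^ 2) := (div_le_iff₀' hs').2 hle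
    linarith
  · have hv_le : v ≤ s * (1 / 2) := mul_le_mul_of_nonneg_left (by linarith) hs'.le
    exact_mod_cast (by linarith : (2 : ℝ) * ⌊v⌋₊ ≤ s)

theorem exists_div_mul_log_two_sub_binEntropy_lt {ρ b : ℝ} (hρ : 0 ≤ ρ) (hb : 2 * ρ < b) :
    ∃ δ : ℝ, 0 < δ ∧ δ ≤ 1 / 8 ∧
      ρ / δ ^ 2 * (Real.log 2 - Real.binEntropy (1 / 2 - (δ + 3 * δ ^ 2))) < b := by
  have hcont : Continuous fun δ : ℝ =>
      2 * ρ * ((1 + 3 * δ) ^ 2 * (1 + 8 * δ * (1 + 3 * δ))) := by fun_prop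
  have hsmall : ∀ᶠ δ : ℝ in nhdsWithin 0 (Set.Ioi 0),
      2 * ρ * ((1 + 3 * δ) ^ 2 * (1 + 8 * δ * (1 + 3 * δ))) < b :=
    nhdsWithin_le_nhds (hcont.continuousAt.eventually_lt_const (by simpa using hb))
  have hmem : ∀ᶠ δ : ℝ in nhdsWithin 0 (Set.Ioi 0), δ ∈ Set.Ioc (0 : ℝ) (1 / 8) :=
    Ioc_mem_nhdsGT (by norm_num)
  obtain ⟨δ, ⟨hδ, hδ'⟩, hδb⟩ := (hmem.and hsmall).exists
  refine ⟨δ, hδ, hδ', lt_of_le_of_lt ?_ hδb⟩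
  calc ρ / δ ^ 2 * (Real.log 2 - Real.binEntropy (1 / 2 - (δ + 3 * δ ^ 2)))
      ≤ ρ / δ ^ 2 * (2 * (δ + 3 * δ ^ 2) ^ 2 + 16 * (δ + 3 * δ ^ 2) ^ 3) := by
        gcongr
        exact log_two_sub_binEntropy_half_sub_le (by positivity) (by nlinarith)
    _ = 2 * ρ * ((1 + 3 * δ) ^ 2 * (1 + 8 * δ * (1 + 3 * δ))) := by
        field_simp
        ring

end Binomial

namespace Bandit

open ProbabilityTheory

section History

variable {K t : ℕ}

theorem pulls_eq_sum (h : History K t) (k : Fin K) :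
    pulls h k = ∑ i, if (h i).1 = k then 1 else 0 := by
  rw [pulls, Finset.card_filter]

theorem pulls_snoc (h : History K t) (x : Fin K × unitInterval) (k : Fin K) :
    pulls (Fin.snoc (α := fun _ => Fin K × unitInterval) h x : History K (t + 1)) k =
      pulls h k + if x.1 = k then 1 else 0 := by
  rw [pulls_eq_sum, pulls_eq_sum, Fin.sum_univ_castSucc]
  simp only [Fin.snoc_castSucc, Fin.snoc_last]

theorem pulls_le (h : History K t) (k : Fin K) : pulls h k ≤ t := by
  simpa [pulls] using Finset.card_le_univ (Finset.univ.filter fun i => (h i).1 = k)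

theorem sum_pulls (h : History K t) : ∑ k, pulls h k = t := by
  simp only [pulls_eq_sum]
  rw [Finset.sum_comm]
  simp

theorem measurable_pulls (k : Fin K) : Measurable fun h : History K t => pulls h k := by
  simp only [pulls_eq_sum]
  exact Finset.measurable_sum _ fun i _ =>
    Measurable.ite ((measurable_fst.comp (measurable_pi_apply i)) (measurableSet_singleton k))
      measurable_const measurable_const

end History

section Draw

variable {K : ℕ} [NeZero K]

theorem lt_sum_Iic_draw (p : PMF (Fin K)) {u : unitInterval} (hu : (u : ℝ) < 1) :
    (u : ℝ) < ∑ j ∈ Finset.Iic (draw p u), (p j).toReal := by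
  have hsum : ∑ j ∈ Finset.Iic (⊤ : Fin K), (p j).toReal = 1 := by
    rw [Finset.Iic_top, ← ENNReal.toReal_sum fun j _ => p.apply_ne_top j,
      ← tsum_fintype (L := .unconditional _), p.tsum_coe, ENNReal.toReal_one]
  have hne : (Finset.univ.filter fun k : Fin K =>
      (u : ℝ) < ∑ j ∈ Finset.Iic k, (p j).toReal).Nonempty :=
    ⟨⊤, Finset.mem_filter.2 ⟨Finset.mem_univ _, hu.trans_eq hsum.symm⟩⟩
  rw [draw, dif_pos hne]
  exact (Finset.mem_filter.1 (Finset.min'_mem _ hne)).2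

theorem sum_Iic_le_of_lt_draw (p : PMF (Fin K)) (u : unitInterval) {l : Fin K}
    (hl : l < draw p u) : ∑ j ∈ Finset.Iic l, (p j).toReal ≤ u := by
  unfold draw at hl
  split_ifs at hl with hne
  · contrapose! hl
    exact Finset.min'_le _ _ (Finset.mem_filter.2 ⟨Finset.mem_univ l, hl⟩)
  · exact absurd hl (Fin.not_lt_zero l)

theorem draw_mem_support (p : PMF (Fin K)) {u : unitInterval} (hu : (u : ℝ) < 1) :
    draw p u ∈ p.support := by
  rw [PMF.mem_support_iff]
  intro hzero
  have hlt : (u : ℝ) < ∑ j ∈ Finset.Iio (draw p u), (p j).toReal := by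
    simpa [← Finset.Iio_insert, hzero] using lt_sum_Iic_draw p hu
  by_cases hmin : IsMin (draw p u)
  · rw [Finset.Iio_eq_empty.2 hmin, Finset.sum_empty] at hlt
    exact hlt.not_ge u.2.1
  · rw [← Finset.Iic_pred_eq_Iio_of_not_isMin hmin] at hlt
    exact hlt.not_ge (sum_Iic_le_of_lt_draw p u (Order.pred_lt_of_not_isMin hmin))

theorem measurable_draw {α : Type*} [MeasurableSpace α] {p : α → PMF (Fin K)}
    {u : α → unitInterval} (hp : ∀ k, Measurable fun x => p x k) (hu : Measurable u) :
    Measurable fun x => draw (p x) (u x) := by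
  classical
  have hlt : Measurable fun x (k : Fin K) =>
      (u x : ℝ) < ∑ j ∈ Finset.Iic k, (p x j).toReal :=
    measurable_pi_lambda _ fun k => measurableSet_setOfPred.1 <|
      measurableSet_lt (measurable_subtype_coe.comp hu)
        (Finset.measurable_sum _ fun j _ => (hp j).ennreal_toReal)
  let least (S : Fin K → Prop) : Fin K :=
    if hne : (Finset.univ.filter S).Nonempty then (Finset.univ.filter S).min' hne else 0
  have hleast : Measurable least := .of_discrete
  convert hleast.comp hlt using 2 with x
  unfold draw
  rfl

end Draw

section Run

variable {K : ℕ} [NeZero K] (σ : Policy K)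

/-- The arm drawn at round `t + 1`. -/
noncomputable def arm (ω : Sample K) (t : ℕ) : Fin K :=
  draw (σ.choice t (run σ ω t)) (ω.2 t)

/-- The entry of the reward table revealed at round `t + 1`. -/
noncomputable def entry (ω : Sample K) (t : ℕ) : Fin K × ℕ :=
  (arm σ ω t, pulls (run σ ω t) (arm σ ω t))

theorem run_succ (ω : Sample K) (t : ℕ) :
    run σ ω (t + 1) = Fin.snoc (α := fun _ => Fin K × unitInterval) (run σ ω t)
      (arm σ ω t, ω.1 (entry σ ω t)) :=
  rfl

theorem pulls_run_zero (ω : Sample K) (k : Fin K) : pulls (run σ ω 0) k = 0 :=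
  Nat.le_zero.1 (pulls_le _ _)

theorem pulls_run_succ (ω : Sample K) (t : ℕ) (k : Fin K) :
    pulls (run σ ω (t + 1)) k = pulls (run σ ω t) k + if arm σ ω t = k then 1 else 0 := by
  rw [run_succ, pulls_snoc]

theorem pulls_run_eq_sum (ω : Sample K) (n : ℕ) (k : Fin K) :
    pulls (run σ ω n) k = ∑ t ∈ Finset.range n, if arm σ ω t = k then 1 else 0 := by
  induction n with
  | zero => rw [pulls_run_zero, Finset.sum_range_zero]
  | succ n ih => rw [pulls_run_succ, ih, Finset.sum_range_succ]

theorem monotone_pulls_run (ω : Sample K) (k : Fin K) : Monotone fun t => pulls (run σ ω t) k :=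
  monotone_nat_of_le_succ fun t => by rw [pulls_run_succ]; exact Nat.le_add_right _ _

theorem sum_comp_arm (ω : Sample K) (n : ℕ) (f : Fin K → ℝ) :
    ∑ t ∈ Finset.range n, f (arm σ ω t) = ∑ k, f k * pulls (run σ ω n) k := by
  simp only [pulls_run_eq_sum, Nat.cast_sum, Nat.cast_ite, Nat.cast_one, Nat.cast_zero,
    Finset.mul_sum, mul_ite, mul_one, mul_zero]
  rw [Finset.sum_comm]
  simp

theorem sum_rewards_run (ω : Sample K) (n : ℕ) :
    ∑ i, ((run σ ω n i).2 : ℝ) = ∑ t ∈ Finset.range n, (ω.1 (entry σ ω t) : ℝ) := by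
  induction n with
  | zero => simp
  | succ n ih =>
    rw [Fin.sum_univ_castSucc, Finset.sum_range_succ]
    simp only [run_succ, Fin.snoc_castSucc, Fin.snoc_last, ih]

theorem sum_arm_rewards_run (ω : Sample K) (n : ℕ) (k : Fin K) :
    ∑ i with (run σ ω n i).1 = k, ((run σ ω n i).2 : ℝ) =
      ∑ s ∈ Finset.range (pulls (run σ ω n) k), (ω.1 (k, s) : ℝ) := by
  induction n with
  | zero => simp [pulls_run_zero]
  | succ n ih =>
    rw [Finset.sum_filter] at ih ⊢
    rw [Fin.sum_univ_castSucc, pulls_run_succ]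
    simp only [run_succ, Fin.snoc_castSucc, Fin.snoc_last, ih, entry]
    split_ifs with h
    · rw [Finset.sum_range_succ, h]
    · simp

/-- The average `X̂_{k,s}` of the first `s` rewards of arm `k`; it is `0` for `s = 0`. -/
noncomputable def sampleMean {K : ℕ} (ω : Sample K) (k : Fin K) (s : ℕ) : ℝ :=
  (∑ u ∈ Finset.range s, (ω.1 (k, u) : ℝ)) / s

theorem empMean_run (ω : Sample K) (t : ℕ) (k : Fin K) :
    empMean (run σ ω t) k = sampleMean ω k (pulls (run σ ω t) k) := by
  rw [empMean, sum_arm_rewards_run, sampleMean]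

theorem ucbIndex_run (ρ : ℝ) (ω : Sample K) (t : ℕ) (k : Fin K) :
    ucbIndex ρ (run σ ω t) k = sampleMean ω k (pulls (run σ ω t) k) +
      √(ρ * Real.log (t + 1) / pulls (run σ ω t) k) := by
  rw [ucbIndex, empMean_run]

theorem run_update_of_pulls_le {x : Fin K × ℕ → unitInterval} {y : ℕ → unitInterval} {t : ℕ}
    {i : Fin K × ℕ} (h : pulls (run σ (x, y) t) i.1 ≤ i.2) (v : unitInterval) :
    run σ (Function.update x i v, y) t = run σ (x, y) t := by
  induction t with
  | zero => rfl
  | succ t ih =>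
    have hrun := ih ((monotone_pulls_run σ (x, y) i.1 t.le_succ).trans h)
    have harm : arm σ (Function.update x i v, y) t = arm σ (x, y) t := by
      simp only [arm, hrun]
    have hentry : entry σ (x, y) t ≠ i := by
      rintro rfl
      simp [pulls_run_succ, entry] at h
    rw [run_succ, run_succ, entry, harm, hrun]
    congr 2
    exact Function.update_of_ne hentry _ _

theorem entry_update_eq_iff (x : Fin K × ℕ → unitInterval) (y : ℕ → unitInterval) (t : ℕ)
    (i : Fin K × ℕ) (v : unitInterval) :
    entry σ (Function.update x i v, y) t = i ↔ entry σ (x, y) t = i := by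
  have himp : ∀ (x : Fin K × ℕ → unitInterval) (v : unitInterval), entry σ (x, y) t = i →
      entry σ (Function.update x i v, y) t = i := by
    intro x v hi
    have hpulls : pulls (run σ (x, y) t) i.1 ≤ i.2 := by rw [← hi, entry]
    simpa only [entry, arm, run_update_of_pulls_le σ hpulls v] using hi
  refine ⟨fun h => ?_, himp x v⟩
  simpa using himp _ (x i) h

theorem measurable_apply_entry {K : ℕ} {e : Sample K → Fin K × ℕ} (he : Measurable e) :
    Measurable fun ω : Sample K => ω.1 (e ω) := by
  have heval : Measurable fun q : Sample K × (Fin K × ℕ) => q.1.1 q.2 :=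
    measurable_from_prod_countable_left fun i => (measurable_pi_apply i).comp measurable_fst
  exact heval.comp (measurable_id.prodMk he)

theorem measurable_arm_of_run {t : ℕ} (h : Measurable fun ω => run σ ω t) :
    Measurable fun ω => arm σ ω t :=
  measurable_draw (fun k => (σ.measurable_choice t k).comp h)
    ((measurable_pi_apply t).comp measurable_snd)

theorem measurable_entry_of_run {t : ℕ} (h : Measurable fun ω => run σ ω t) :
    Measurable fun ω => entry σ ω t := by
  have hpulls : Measurable fun q : History K t × Fin K => pulls q.1 q.2 :=
    measurable_from_prod_countable_left fun k => measurable_pulls k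
  have harm := measurable_arm_of_run σ h
  exact harm.prodMk (hpulls.comp (h.prodMk harm))

theorem measurable_run (t : ℕ) : Measurable fun ω => run σ ω t := by
  induction t with
  | zero => exact measurable_pi_lambda _ fun i => i.elim0
  | succ t ih =>
    refine measurable_pi_lambda _ fun i => ?_
    refine Fin.lastCases ?_ (fun i => ?_) i
    · simp only [run_succ, Fin.snoc_last]
      exact (measurable_arm_of_run σ ih).prodMk
        (measurable_apply_entry (measurable_entry_of_run σ ih))
    · simp only [run_succ, Fin.snoc_castSucc]
      exact (measurable_pi_apply i).comp ih

theorem measurable_arm (t : ℕ) : Measurable fun ω => arm σ ω t :=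
  measurable_arm_of_run σ (measurable_run σ t)

theorem measurable_entry (t : ℕ) : Measurable fun ω => entry σ ω t :=
  measurable_entry_of_run σ (measurable_run σ t)

theorem measurable_pulls_run (t : ℕ) (k : Fin K) : Measurable fun ω => pulls (run σ ω t) k :=
  (measurable_pulls k).comp (measurable_run σ t)

end Run

section Law

variable {K : ℕ} (θ : Env K)

instance isProbabilityMeasure_law : IsProbabilityMeasure (law θ) := by
  unfold law
  infer_instance

theorem measurePreserving_reward (i : Fin K × ℕ) :
    MeasurePreserving (fun ω : Sample K => ω.1 i) (law θ) (θ i.1 : Measure unitInterval) :=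
  (measurePreserving_eval_infinitePi
    (fun i : Fin K × ℕ => (θ i.1 : Measure unitInterval)) i).comp measurePreserving_fst

theorem measurePreserving_seed (t : ℕ) :
    MeasurePreserving (fun ω : Sample K => ω.2 t) (law θ) volume :=
  (measurePreserving_eval_infinitePi (fun _ : ℕ => (volume : Measure unitInterval)) t).comp
    measurePreserving_snd

theorem measurePreserving_update_law (i : Fin K × ℕ) :
    MeasurePreserving (fun q : Sample K × unitInterval => (Function.update q.1.1 i q.2, q.1.2))
      ((law θ).prod (θ i.1 : Measure unitInterval)) (law θ) := by
  let rewards := Measure.infinitePi fun i : Fin K × ℕ => (θ i.1 : Measure unitInterval)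
  let seeds := Measure.infinitePi fun _ : ℕ => (volume : Measure unitInterval)
  let ν : Measure unitInterval := θ i.1
  have hassoc := measurePreserving_prodAssoc rewards seeds ν
  have hswap := (MeasurePreserving.id rewards).prod
    (Measure.measurePreserving_swap (μ := seeds) (ν := ν))
  have hassoc' := (measurePreserving_prodAssoc rewards ν seeds).symm
  have hupdate := (measurePreserving_update_infinitePi
    (fun i : Fin K × ℕ => (θ i.1 : Measure unitInterval)) i).prod (MeasurePreserving.id seeds)
  exact hupdate.comp (hassoc'.comp (hswap.comp hassoc))

theorem measurable_reward (i : Fin K × ℕ) : Measurable fun ω : Sample K => (ω.1 i : ℝ) :=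
  measurable_subtype_coe.comp ((measurable_pi_apply i).comp measurable_fst)

theorem integrable_apply_entry {e : Sample K → Fin K × ℕ} (he : Measurable e) :
    Integrable (fun ω : Sample K => (ω.1 (e ω) : ℝ)) (law θ) :=
  .of_mem_Icc 0 1 (measurable_subtype_coe.comp (measurable_apply_entry he)).aemeasurable
    (ae_of_all _ fun ω => (ω.1 (e ω)).2)

theorem integral_reward (i : Fin K × ℕ) : ∫ ω : Sample K, (ω.1 i : ℝ) ∂law θ = mean θ i.1 := by
  have hmp := measurePreserving_reward θ i
  rw [mean, ← hmp.map_eq, integral_map hmp.aemeasurable]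
  exact measurable_subtype_coe.aestronglyMeasurable

theorem setIntegral_reward_of_update_mem_iff {A : Set (Sample K)} (hA : MeasurableSet A)
    {i : Fin K × ℕ} (hinv : ∀ x y v, (Function.update x i v, y) ∈ A ↔ (x, y) ∈ A) :
    ∫ ω in A, (ω.1 i : ℝ) ∂law θ = (law θ).real A * mean θ i.1 :=
  setIntegral_eq_measureReal_mul_integral_of_resample (measurePreserving_update_law θ i) hA
    (Set.ext fun q => by simpa using hinv q.1.1 q.1.2 q.2)
    (measurable_reward i).aestronglyMeasurable fun q => by simp only [Function.update_self]

end Law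

section Regret

variable {K : ℕ} [NeZero K] (σ : Policy K) (θ : Env K)

theorem ae_arm_mem_support :
    ∀ᵐ ω ∂law θ, ∀ t, arm σ ω t ∈ (σ.choice t (run σ ω t)).support := by
  rw [ae_all_iff]
  intro t
  have hone : ∀ᵐ u : unitInterval, u ≠ 1 := Measure.ae_ne volume 1
  filter_upwards [(measurePreserving_seed θ t).quasiMeasurePreserving.ae hone] with ω hω
  exact draw_mem_support _ (unitInterval.lt_one_iff_ne_one.2 hω)

theorem integrable_comp_arm (f : Fin K → ℝ) (t : ℕ) :
    Integrable (fun ω => f (arm σ ω t)) (law θ) :=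
  (Integrable.of_finite (μ := (law θ).map fun ω => arm σ ω t)).comp_measurable
    (measurable_arm σ t)

-- The arm drawn at round `t + 1` is decided before the entry it reveals is looked at.
theorem integral_reward_entry (t : ℕ) :
    ∫ ω, (ω.1 (entry σ ω t) : ℝ) ∂law θ = ∫ ω, mean θ (arm σ ω t) ∂law θ := by
  have he := measurable_entry σ t
  refine integral_eq_of_forall_setIntegral_fiber_eq he (integrable_apply_entry θ he)
    (integrable_comp_arm σ θ _ t) fun i => ?_
  have hmeas : MeasurableSet {ω | entry σ ω t = i} := he (measurableSet_singleton i)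
  calc ∫ ω in {ω | entry σ ω t = i}, (ω.1 (entry σ ω t) : ℝ) ∂law θ
      = ∫ ω in {ω | entry σ ω t = i}, (ω.1 i : ℝ) ∂law θ :=
        setIntegral_congr_fun hmeas fun ω hω => by rw [hω]
    _ = (law θ).real {ω | entry σ ω t = i} * mean θ i.1 :=
        setIntegral_reward_of_update_mem_iff θ hmeas fun x y v => entry_update_eq_iff σ x y t i v
    _ = ∫ _ in {ω | entry σ ω t = i}, mean θ i.1 ∂law θ := by
        rw [setIntegral_const, smul_eq_mul]
    _ = ∫ ω in {ω | entry σ ω t = i}, mean θ (arm σ ω t) ∂law θ :=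
        setIntegral_congr_fun hmeas fun ω hω => by rw [← hω, entry]

theorem integrable_pulls_run (n : ℕ) (k : Fin K) :
    Integrable (fun ω => (pulls (run σ ω n) k : ℝ)) (law θ) :=
  .of_mem_Icc 0 n (measurable_from_nat.comp (measurable_pulls_run σ n k)).aemeasurable
    (ae_of_all _ fun _ => ⟨Nat.cast_nonneg _, Nat.cast_le.2 (pulls_le _ _)⟩)

theorem expRegret_eq_sum_gap_mul_integral_pulls (n : ℕ) :
    expRegret σ θ n = ∑ k, gap θ k * ∫ ω, (pulls (run σ ω n) k : ℝ) ∂law θ := by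
  have hbest : ∀ t ∈ Finset.range n,
      Integrable (fun ω : Sample K => (ω.1 (bestArm θ, t) : ℝ)) (law θ) := fun t _ =>
    integrable_apply_entry θ measurable_const
  have hreceived : ∀ t ∈ Finset.range n,
      Integrable (fun ω => (ω.1 (entry σ ω t) : ℝ)) (law θ) := fun t _ =>
    integrable_apply_entry θ (measurable_entry σ t)
  calc expRegret σ θ n
      = ∑ t ∈ Finset.range n, ∫ ω, gap θ (arm σ ω t) ∂law θ := by
        simp only [expRegret, regret, sum_rewards_run]
        rw [integral_sub (integrable_finsetSum _ hbest) (integrable_finsetSum _ hreceived),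
          integral_finsetSum _ hbest, integral_finsetSum _ hreceived, ← Finset.sum_sub_distrib]
        refine Finset.sum_congr rfl fun t _ => ?_
        simp only [gap]
        rw [integral_reward, integral_reward_entry,
          integral_sub (integrable_const _) (integrable_comp_arm σ θ _ t), integral_const,
          probReal_univ, one_smul]
    _ = ∫ ω, ∑ k, gap θ k * pulls (run σ ω n) k ∂law θ := by
        rw [← integral_finsetSum _ fun t _ => integrable_comp_arm σ θ _ t]
        simp only [sum_comp_arm]
    _ = ∑ k, gap θ k * ∫ ω, (pulls (run σ ω n) k : ℝ) ∂law θ := by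
        rw [integral_finsetSum _ fun k _ => (integrable_pulls_run σ θ n k).const_mul _]
        simp only [integral_const_mul]

theorem mean_le_mean_bestArm (k : Fin K) : mean θ k ≤ mean θ (bestArm θ) :=
  (Finite.exists_max (mean θ)).choose_spec k

theorem gap_nonneg (k : Fin K) : 0 ≤ gap θ k :=
  sub_nonneg.2 (mean_le_mean_bestArm θ k)

theorem expRegret_nonneg (n : ℕ) : 0 ≤ expRegret σ θ n := by
  rw [expRegret_eq_sum_gap_mul_integral_pulls]
  exact Finset.sum_nonneg fun k _ => mul_nonneg (gap_nonneg θ k)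
    (integral_nonneg fun ω => Nat.cast_nonneg _)

end Regret

section Deviation

variable {K : ℕ} (θ : Env K) (k : Fin K)

theorem iIndepFun_reward :
    iIndepFun (fun (s : ℕ) (ω : Sample K) => (ω.1 (k, s) : ℝ)) (law θ) := by
  have htable : iIndepFun (fun (i : Fin K × ℕ) (ω : Sample K) => ω.1 i) (law θ) := by
    rw [iIndepFun_iff_map_fun_eq_infinitePi_map fun i => (measurePreserving_reward θ i).measurable]
    simp only [(measurePreserving_reward θ _).map_eq]
    exact (measurePreserving_fst : MeasurePreserving Prod.fst (law θ) _).map_eq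
  exact (htable.precomp (Prod.mk_right_injective k)).comp (fun _ x => (x : ℝ))
    fun _ => measurable_subtype_coe

theorem iIndepFun_reward_sub_mean :
    iIndepFun (fun (s : ℕ) (ω : Sample K) => (ω.1 (k, s) : ℝ) - mean θ k) (law θ) :=
  (iIndepFun_reward θ k).comp (fun _ x => x - mean θ k) fun _ => measurable_id.sub_const _

theorem hasSubgaussianMGF_reward_sub_mean (s : ℕ) :
    HasSubgaussianMGF (fun ω : Sample K => (ω.1 (k, s) : ℝ) - mean θ k) (1 / 4) (law θ) := by
  have h := hasSubgaussianMGF_of_mem_Icc (μ := law θ) (a := 0) (b := 1)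
    (measurable_reward (k, s)).aemeasurable (Eventually.of_forall fun ω => (ω.1 (k, s)).2)
  rw [integral_reward] at h
  convert h using 1
  norm_num

theorem integral_reward_sub_mean (s : ℕ) :
    ∫ ω : Sample K, ((ω.1 (k, s) : ℝ) - mean θ k) ∂law θ = 0 := by
  rw [integral_sub (integrable_apply_entry θ measurable_const) (integrable_const _),
    integral_reward, integral_const, probReal_univ, one_smul, sub_self]

theorem sum_reward_sub_mean_div (ω : Sample K) {s : ℕ} (hs : s ≠ 0) :
    (∑ i ∈ Finset.range s, ((ω.1 (k, i) : ℝ) - mean θ k)) / s = sampleMean ω k s - mean θ k := by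
  rw [Finset.sum_sub_distrib, Finset.sum_const, Finset.card_range, nsmul_eq_mul, sub_div,
    mul_div_cancel_left₀ _ (Nat.cast_ne_zero.2 hs), sampleMean]

/-- The event that one of the sample means of arm `k` available up to round `t` exceeds the mean
by at least the exploration bonus of `UCB(ρ)` at round `t`. -/
def overestimated (ρ : ℝ) (t : ℕ) : Set (Sample K) :=
  {ω | ∃ s ∈ Finset.Icc 1 t, mean θ k + √(ρ * Real.log t / s) ≤ sampleMean ω k s}

/-- The event that one of the sample means of arm `k` available up to round `t` is below the mean
by at least the exploration bonus of `UCB(ρ)` at round `t`. -/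
def underestimated (ρ : ℝ) (t : ℕ) : Set (Sample K) :=
  {ω | ∃ s ∈ Finset.Icc 1 t, sampleMean ω k s + √(ρ * Real.log t / s) ≤ mean θ k}

variable {ρ β : ℝ} {t : ℕ}

theorem measureReal_overestimated_le (hρ : 0 < ρ) (hβ : β ∈ Set.Ioo 0 1) (ht : 2 ≤ t) :
    (law θ).real (overestimated θ k ρ t) ≤
      (Real.log t / Real.log (1 / β) + 1) * (t : ℝ) ^ (-(2 * ρ * β)) := by
  have heq : overestimated θ k ρ t = {ω | ∃ s ∈ Finset.Icc 1 t,
      √(ρ * Real.log t / s) ≤ (∑ i ∈ Finset.range s, ((ω.1 (k, i) : ℝ) - mean θ k)) / s} := by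
    ext ω
    refine exists_congr fun s => and_congr_right fun hs => ?_
    rw [sum_reward_sub_mean_div _ _ _ (Nat.one_le_iff_ne_zero.1 (Finset.mem_Icc.1 hs).1),
      le_sub_iff_add_le']
  have hexp : 2 * ρ * β = β * ρ / (2 * (1 / 4 : NNReal)) := by push_cast; ring
  rw [heq, hexp]
  exact measureReal_exists_sqrt_mul_log_div_le_average_le (iIndepFun_reward_sub_mean θ k)
    (fun s => (measurable_reward (k, s)).sub_const _) (hasSubgaussianMGF_reward_sub_mean θ k)
    (integral_reward_sub_mean θ k) (by norm_num) hρ hβ ht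

theorem measureReal_underestimated_le (hρ : 0 < ρ) (hβ : β ∈ Set.Ioo 0 1) (ht : 2 ≤ t) :
    (law θ).real (underestimated θ k ρ t) ≤
      (Real.log t / Real.log (1 / β) + 1) * (t : ℝ) ^ (-(2 * ρ * β)) := by
  have heq : underestimated θ k ρ t = {ω | ∃ s ∈ Finset.Icc 1 t,
      √(ρ * Real.log t / s) ≤ (∑ i ∈ Finset.range s, -((ω.1 (k, i) : ℝ) - mean θ k)) / s} := by
    ext ω
    refine exists_congr fun s => and_congr_right fun hs => ?_
    rw [Finset.sum_neg_distrib, neg_div,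
      sum_reward_sub_mean_div _ _ _ (Nat.one_le_iff_ne_zero.1 (Finset.mem_Icc.1 hs).1), neg_sub,
      le_sub_iff_add_le']
  have hexp : 2 * ρ * β = β * ρ / (2 * (1 / 4 : NNReal)) := by push_cast; ring
  rw [heq, hexp]
  exact measureReal_exists_sqrt_mul_log_div_le_average_le
    ((iIndepFun_reward_sub_mean θ k).comp (fun _ => Neg.neg) fun _ => measurable_neg)
    (fun s => ((measurable_reward (k, s)).sub_const _).neg)
    (fun s => (hasSubgaussianMGF_reward_sub_mean θ k s).neg)
    (fun s => (integral_neg _).trans (by rw [integral_reward_sub_mean, neg_zero])) (by norm_num)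
    hρ hβ ht

end Deviation

section UpperBound

variable {K : ℕ} {ρ β : ℝ} {σ : Policy K}

theorem IsUCB.pulls_ne_zero_and_ucbIndex_le (hσ : IsUCB ρ σ) {t : ℕ} {h : History K t}
    {k : Fin K} (hk : k ∈ (σ.choice t h).support) (hpulls : pulls h k ≠ 0) (j : Fin K) :
    pulls h j ≠ 0 ∧ ucbIndex ρ h j ≤ ucbIndex ρ h k := by
  have hall : ∀ i, pulls h i ≠ 0 := fun i hi => hpulls ((hσ t h k hk).1 ⟨i, hi⟩)
  exact ⟨hall j, (hσ t h k hk).2 hall j⟩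

variable [NeZero K] {θ : Env K} {k : Fin K}

theorem mem_underestimated_union_overestimated {ω : Sample K} {t : ℕ}
    (hidx : ucbIndex ρ (run σ ω t) (bestArm θ) ≤ ucbIndex ρ (run σ ω t) k)
    (hbest : pulls (run σ ω t) (bestArm θ) ≠ 0) (hk : pulls (run σ ω t) k ≠ 0)
    (hbonus : √(ρ * Real.log (t + 1) / pulls (run σ ω t) k) ≤ gap θ k / 2) :
    ω ∈ underestimated θ (bestArm θ) ρ (t + 1) ∪ overestimated θ k ρ (t + 1) := by
  have hmem : ∀ j, pulls (run σ ω t) j ≠ 0 → pulls (run σ ω t) j ∈ Finset.Icc 1 (t + 1) :=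
    fun j hj => Finset.mem_Icc.2 ⟨Nat.one_le_iff_ne_zero.2 hj, (pulls_le _ _).trans t.le_succ⟩
  simp only [ucbIndex_run] at hidx
  by_contra hnot
  simp only [underestimated, overestimated, Set.mem_union, Set.mem_ofPred_eq, not_or, not_exists,
    not_and, not_le, Nat.cast_add_one] at hnot
  have hlower := hnot.1 _ (hmem _ hbest)
  have hupper := hnot.2 _ (hmem _ hk)
  rw [gap] at hbonus
  linarith

theorem ae_setOf_arm_eq_le_underestimated_union_overestimated (hρ : 0 < ρ) (hσ : IsUCB ρ σ)
    (hgap : 0 < gap θ k) {t n u : ℕ} (htn : t < n) (hu : u ≠ 0)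
    (hnu : 4 * (ρ * Real.log n) / gap θ k ^ 2 ≤ u) :
    ({ω | arm σ ω t = k ∧ u ≤ pulls (run σ ω t) k} : Set (Sample K)) ≤ᵐ[law θ]
      (underestimated θ (bestArm θ) ρ (t + 1) ∪ overestimated θ k ρ (t + 1) : Set (Sample K)) := by
  filter_upwards [ae_arm_mem_support σ θ] with ω hω ⟨harm, hpulls⟩
  have hpos : 0 < pulls (run σ ω t) k := (Nat.pos_of_ne_zero hu).trans_le hpulls
  obtain ⟨hbest, hidx⟩ :=
    hσ.pulls_ne_zero_and_ucbIndex_le (harm ▸ hω t) hpos.ne' (bestArm θ)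
  refine mem_underestimated_union_overestimated hidx hbest hpos.ne'
    (sqrt_div_le_half (y := ρ * Real.log n) ?_ (Nat.cast_pos.2 hpos) hgap
      (hnu.trans (Nat.cast_le.2 hpulls)))
  gcongr
  exact_mod_cast htn

theorem measureReal_setOf_arm_eq_le (hρ : 0 < ρ) (hσ : IsUCB ρ σ) (hβ : β ∈ Set.Ioo 0 1)
    (hgap : 0 < gap θ k) {t n u : ℕ} (ht : 1 ≤ t) (htn : t < n) (hu : u ≠ 0)
    (hnu : 4 * (ρ * Real.log n) / gap θ k ^ 2 ≤ u) :
    (law θ).real {ω | arm σ ω t = k ∧ u ≤ pulls (run σ ω t) k} ≤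
      2 * (Real.log n / Real.log (1 / β) + 1) * ((t : ℝ) + 1) ^ (-(2 * ρ * β)) := by
  have hlog : 0 < Real.log (1 / β) := Real.log_pos (one_lt_one_div hβ.1 hβ.2)
  have ht2 : 2 ≤ t + 1 := Nat.succ_le_succ ht
  calc (law θ).real {ω | arm σ ω t = k ∧ u ≤ pulls (run σ ω t) k}
      ≤ (law θ).real (underestimated θ (bestArm θ) ρ (t + 1) ∪ overestimated θ k ρ (t + 1)) :=
        ENNReal.toReal_mono (measure_ne_top _ _) (measure_mono_ae
          (ae_setOf_arm_eq_le_underestimated_union_overestimated hρ hσ hgap htn hu hnu))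
    _ ≤ (law θ).real (underestimated θ (bestArm θ) ρ (t + 1)) +
          (law θ).real (overestimated θ k ρ (t + 1)) := measureReal_union_le _ _
    _ ≤ 2 * (Real.log (t + 1 : ℕ) / Real.log (1 / β) + 1) *
          ((t + 1 : ℕ) : ℝ) ^ (-(2 * ρ * β)) := by
        rw [mul_assoc, two_mul]
        exact add_le_add (measureReal_underestimated_le θ _ hρ hβ ht2)
          (measureReal_overestimated_le θ k hρ hβ ht2)
    _ ≤ 2 * (Real.log n / Real.log (1 / β) + 1) * ((t : ℝ) + 1) ^ (-(2 * ρ * β)) := by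
        rw [← Nat.cast_add_one]
        gcongr
        exact htn

theorem pulls_run_le_add_sum (σ : Policy K) (ω : Sample K) (k : Fin K) {u : ℕ} (hu : u ≠ 0)
    (n : ℕ) : pulls (run σ ω n) k ≤
      u + ∑ t ∈ Finset.Ico 1 n, if arm σ ω t = k ∧ u ≤ pulls (run σ ω t) k then 1 else 0 := by
  induction n with
  | zero => simp [pulls_run_zero]
  | succ n ih =>
    rw [pulls_run_succ]
    rcases n.eq_zero_or_pos with rfl | hn
    · rw [pulls_run_zero]
      split_ifs <;> omega
    · rw [Finset.sum_Ico_succ_top hn]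
      split_ifs <;> grind

theorem integral_pulls_run_le_add_sum (σ : Policy K) (θ : Env K) (k : Fin K) {u : ℕ}
    (hu : u ≠ 0) (n : ℕ) :
    ∫ ω, (pulls (run σ ω n) k : ℝ) ∂law θ ≤
      u + ∑ t ∈ Finset.Ico 1 n, (law θ).real {ω | arm σ ω t = k ∧ u ≤ pulls (run σ ω t) k} := by
  let A (t : ℕ) : Set (Sample K) := {ω | arm σ ω t = k ∧ u ≤ pulls (run σ ω t) k}
  have hA : ∀ t, MeasurableSet (A t) := fun t =>
    (measurable_arm σ t (measurableSet_singleton k)).inter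
      (measurable_pulls_run σ t k measurableSet_Ici)
  have hint : ∀ t, Integrable ((A t).indicator 1 : Sample K → ℝ) (law θ) := fun t =>
    (integrable_const 1).indicator (hA t)
  calc ∫ ω, (pulls (run σ ω n) k : ℝ) ∂law θ
      ≤ ∫ ω, ((u : ℝ) + ∑ t ∈ Finset.Ico 1 n, (A t).indicator 1 ω) ∂law θ := by
        refine integral_mono (integrable_pulls_run σ θ n k)
          ((integrable_const _).add (integrable_finsetSum _ fun t _ => hint t)) fun ω => ?_
        simp only [Set.indicator_apply, A, Set.mem_ofPred_eq, Pi.one_apply]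
        exact_mod_cast pulls_run_le_add_sum σ ω k hu n
    _ = u + ∑ t ∈ Finset.Ico 1 n, (law θ).real (A t) := by
        rw [integral_add (integrable_const _) (integrable_finsetSum _ fun t _ => hint t),
          integral_finsetSum _ fun t _ => hint t, integral_const, probReal_univ, one_smul]
        simp only [integral_indicator_one (hA _)]

theorem integral_pulls_run_le (hρ : 0 < ρ) (hσ : IsUCB ρ σ) (hβ : β ∈ Set.Ioo 0 1)
    (hρβ : 2 * ρ * β < 1) (hgap : 0 < gap θ k) {n : ℕ} (hn : 1 ≤ n) :
    ∫ ω, (pulls (run σ ω n) k : ℝ) ∂law θ ≤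
      4 * (ρ * Real.log n) / gap θ k ^ 2 + 1 + 2 * (Real.log n / Real.log (1 / β) + 1) *
        (((n : ℝ) ^ (1 - 2 * ρ * β) - 1) / (1 - 2 * ρ * β)) := by
  have hlog : 0 < Real.log (1 / β) := Real.log_pos (one_lt_one_div hβ.1 hβ.2)
  have hβ0 : 0 < β := hβ.1
  set x := 4 * (ρ * Real.log n) / gap θ k ^ 2
  have hfloor : (⌊x⌋₊ : ℝ) ≤ x := Nat.floor_le (by positivity)
  refine (integral_pulls_run_le_add_sum σ θ k (Nat.succ_ne_zero ⌊x⌋₊) n).trans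
    (add_le_add (by push_cast; linarith) ?_)
  calc ∑ t ∈ Finset.Ico 1 n, (law θ).real {ω | arm σ ω t = k ∧ ⌊x⌋₊ + 1 ≤ pulls (run σ ω t) k}
      ≤ ∑ t ∈ Finset.Ico 1 n,
          2 * (Real.log n / Real.log (1 / β) + 1) * ((t : ℝ) + 1) ^ (-(2 * ρ * β)) :=
        Finset.sum_le_sum fun t ht => measureReal_setOf_arm_eq_le hρ hσ hβ hgap
          (Finset.mem_Ico.1 ht).1 (Finset.mem_Ico.1 ht).2 (Nat.succ_ne_zero ⌊x⌋₊)
          (by exact_mod_cast (Nat.lt_floor_add_one x).le)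
    _ ≤ 2 * (Real.log n / Real.log (1 / β) + 1) *
          (((n : ℝ) ^ (1 - 2 * ρ * β) - 1) / (1 - 2 * ρ * β)) := by
        rw [← Finset.mul_sum]
        gcongr
        exact sum_Ico_rpow_neg_le (by positivity) hρβ hn

theorem gap_mul_integral_pulls_run_le (hρ : 0 < ρ) (hσ : IsUCB ρ σ) (hβ : β ∈ Set.Ioo 0 1)
    (hρβ : 2 * ρ * β < 1) (hgap : 0 < gap θ k) {n : ℕ} (hn : 1 ≤ n) :
    gap θ k * ∫ ω, (pulls (run σ ω n) k : ℝ) ∂law θ ≤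
      4 * ρ * Real.log n / gap θ k + 2 * gap θ k * (Real.log n / Real.log (1 / β) + 1) *
        ((n : ℝ) ^ (1 - 2 * ρ * β) / (1 - 2 * ρ * β)) := by
  have hlog : 0 < Real.log (1 / β) := Real.log_pos (one_lt_one_div hβ.1 hβ.2)
  have hquot : 0 ≤ Real.log n / Real.log (1 / β) := by positivity
  have hexp : 0 < 1 - 2 * ρ * β := sub_pos.2 hρβ
  have hexp_inv : 1 ≤ 1 / (1 - 2 * ρ * β) := by
    have := mul_pos hρ hβ.1
    exact one_le_one_div hexp (by linarith)
  set M := Real.log n / Real.log (1 / β) + 1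
  have hM : 1 ≤ M * (1 / (1 - 2 * ρ * β)) :=
    one_le_mul_of_one_le_of_one_le (le_add_of_nonneg_left hquot) hexp_inv
  calc gap θ k * ∫ ω, (pulls (run σ ω n) k : ℝ) ∂law θ
      ≤ gap θ k * (4 * (ρ * Real.log n) / gap θ k ^ 2 + 1 +
          2 * M * (((n : ℝ) ^ (1 - 2 * ρ * β) - 1) / (1 - 2 * ρ * β))) :=
        mul_le_mul_of_nonneg_left (integral_pulls_run_le hρ hσ hβ hρβ hgap hn) hgap.le
    _ = 4 * ρ * Real.log n / gap θ k + 2 * gap θ k * M *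
          ((n : ℝ) ^ (1 - 2 * ρ * β) / (1 - 2 * ρ * β)) +
          gap θ k * (1 - 2 * (M * (1 / (1 - 2 * ρ * β)))) := by
        field_simp
        ring
    _ ≤ _ := add_le_of_nonpos_right (mul_nonpos_of_nonneg_of_nonpos hgap.le (by linarith))

theorem expRegret_le (hρ : 0 < ρ) (hσ : IsUCB ρ σ) (θ : Env K) (hβ : β ∈ Set.Ioo 0 1)
    (hρβ : 2 * ρ * β < 1) {n : ℕ} (hn : 1 ≤ n) :
    expRegret σ θ n ≤ ∑ k with 0 < gap θ k,
      (4 * ρ * Real.log n / gap θ k + 2 * gap θ k * (Real.log n / Real.log (1 / β) + 1) *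
        ((n : ℝ) ^ (1 - 2 * ρ * β) / (1 - 2 * ρ * β))) := by
  rw [expRegret_eq_sum_gap_mul_integral_pulls, Finset.sum_filter]
  refine Finset.sum_le_sum fun k _ => ?_
  split_ifs with hgap
  · exact gap_mul_integral_pulls_run_le hρ hσ hβ hρβ hgap hn
  · rw [le_antisymm (not_lt.1 hgap) (gap_nonneg θ k), zero_mul]

theorem isLittleO_regretBound {a c : ℝ} (hc : 0 < c) (hca : c < a) (ρ L Δ : ℝ) :
    (fun n : ℕ => 4 * ρ * Real.log n / Δ + 2 * Δ * (Real.log n / L + 1) * ((n : ℝ) ^ c / c))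
      =o[atTop] fun n : ℕ => (n : ℝ) ^ a := by
  have hlog : (fun n : ℕ => Real.log n) =o[atTop] fun n : ℕ => (n : ℝ) ^ a := by
    simpa using isLittleO_log_mul_rpow_natCast (hc.trans hca)
  refine ((hlog.const_mul_left (4 * ρ / Δ)).add
    (((isLittleO_log_mul_rpow_natCast hca).const_mul_left (2 * Δ / L / c)).add
      ((isLittleO_rpow_natCast hca).const_mul_left (2 * Δ / c)))).congr_left fun n => ?_
  ring

theorem IsUCB.isConsistent (hρ : 0 < ρ) (hσ : IsUCB ρ σ) (Θ : Set (Env K)) :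
    IsConsistent (max (1 - 2 * ρ) 0) Θ σ := by
  intro a ha θ _
  obtain ⟨c, hlo, hhi⟩ := exists_between
    (lt_min ha (max_lt (by linarith : 1 - 2 * ρ < 1) one_pos))
  obtain ⟨hc, hc0⟩ := max_lt_iff.1 hlo
  obtain ⟨hca, hc1⟩ := lt_min_iff.1 hhi
  have hβ : (1 - c) / (2 * ρ) ∈ Set.Ioo 0 1 :=
    ⟨div_pos (by linarith) (by linarith), by rw [div_lt_one (by linarith)]; linarith⟩
  have hρβ : 2 * ρ * ((1 - c) / (2 * ρ)) = 1 - c := by field_simp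
  refine IsBigO.trans_isLittleO (IsBigO.of_bound 1 ?_) (IsLittleO.fun_sum (s := {k | 0 < gap θ k})
    fun k _ => isLittleO_regretBound hc0 hca ρ (Real.log (1 / ((1 - c) / (2 * ρ)))) (gap θ k))
  filter_upwards [eventually_ge_atTop 1] with n hn
  have hle := expRegret_le hρ hσ θ hβ (by linarith) hn
  rw [hρβ, sub_sub_cancel] at hle
  rw [one_mul, Real.norm_of_nonneg (expRegret_nonneg σ θ n)]
  exact hle.trans (le_abs_self _)

end UpperBound

section PullCounts

variable {K : ℕ} [NeZero K] {ρ : ℝ} {σ : Policy K}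

theorem pulls_run_le_of_forall_lt_ucbIndex (hρ : 0 ≤ ρ) (hσ : IsUCB ρ σ) {ω : Sample K}
    (hsupp : ∀ t, arm σ ω t ∈ (σ.choice t (run σ ω t)).support) {k j : Fin K} {s n : ℕ}
    (hs : s ≠ 0)
    (hlt : ∀ t < n, pulls (run σ ω t) j ≠ 0 →
      sampleMean ω k s + √(ρ * Real.log n / s) < ucbIndex ρ (run σ ω t) j)
    {t : ℕ} (ht : t ≤ n) : pulls (run σ ω t) k ≤ s := by
  induction t with
  | zero => exact (pulls_run_zero σ ω k).trans_le (Nat.zero_le s)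
  | succ t ih =>
    rw [pulls_run_succ]
    by_contra! hdrawn
    obtain ⟨harm, hpulls⟩ : arm σ ω t = k ∧ pulls (run σ ω t) k = s := by
      have := ih (by omega)
      split_ifs at hdrawn with harm <;> grind
    obtain ⟨hj, hindex⟩ :=
      hσ.pulls_ne_zero_and_ucbIndex_le (harm ▸ hsupp t) (by rwa [hpulls]) j
    have hlog : Real.log ((t : ℝ) + 1) ≤ Real.log n :=
      Real.log_le_log (by positivity) (by exact_mod_cast ht)
    refine (hlt t ht hj).not_ge (hindex.trans ?_)
    rw [ucbIndex_run, hpulls]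
    gcongr

theorem mul_integral_sub_pulls_run_le_expRegret (σ : Policy K) {θ : Env K} {k : Fin K} {Δ : ℝ}
    (hΔ : ∀ j ≠ k, Δ ≤ gap θ j) (n : ℕ) :
    Δ * ∫ ω, ((n : ℝ) - pulls (run σ ω n) k) ∂law θ ≤ expRegret σ θ n := by
  have hothers : ∀ ω : Sample K, (n : ℝ) - pulls (run σ ω n) k =
      ∑ j ∈ Finset.univ.erase k, (pulls (run σ ω n) j : ℝ) := by
    intro ω
    rw [sub_eq_iff_eq_add, Finset.sum_erase_add _ _ (Finset.mem_univ k)]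
    exact_mod_cast (sum_pulls (run σ ω n)).symm
  simp only [hothers]
  rw [integral_finsetSum _ fun j _ => integrable_pulls_run σ θ n j, Finset.mul_sum,
    expRegret_eq_sum_gap_mul_integral_pulls, ← Finset.sum_erase_add _ _ (Finset.mem_univ k)]
  refine le_add_of_le_of_nonneg (Finset.sum_le_sum fun j hj => ?_)
    (mul_nonneg (gap_nonneg θ k) (integral_nonneg fun ω => Nat.cast_nonneg _))
  exact mul_le_mul_of_nonneg_right (hΔ j (Finset.ne_of_mem_erase hj))
    (integral_nonneg fun ω => Nat.cast_nonneg _)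

theorem mul_measureReal_le_integral_sub_pulls_run (σ : Policy K) {θ : Env K} {k : Fin K}
    {E : Set (Sample K)} (hE : MeasurableSet E) {s n : ℕ}
    (hpulls : ∀ᵐ ω ∂law θ, ω ∈ E → pulls (run σ ω n) k ≤ s) :
    ((n : ℝ) - s) * (law θ).real E ≤ ∫ ω, ((n : ℝ) - pulls (run σ ω n) k) ∂law θ := by
  rw [mul_comm, ← smul_eq_mul, ← integral_indicator_const _ hE]
  refine integral_mono_ae ((integrable_const _).indicator hE)
    ((integrable_const _).sub (integrable_pulls_run σ θ n k)) ?_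
  filter_upwards [hpulls] with ω hω
  by_cases hmem : ω ∈ E
  · rw [Set.indicator_of_mem hmem]
    gcongr
    exact hω hmem
  · rw [Set.indicator_of_notMem hmem, sub_nonneg]
    exact_mod_cast pulls_le _ _

end PullCounts

section CoinEnvironment

variable {K : ℕ} [NeZero K]

theorem integral_twoPoint (p a b : unitInterval) :
    ∫ x : unitInterval, (x : ℝ) ∂(twoPoint p a b : Measure unitInterval) =
      p * a + (1 - p) * b := by
  have hint : ∀ (r : ENNReal) (c : unitInterval), r ≠ ⊤ →
      Integrable (fun x : unitInterval => (x : ℝ)) (r • Measure.dirac c) := fun r c hr =>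
    (integrable_dirac enorm_lt_top).smul_measure hr
  rw [twoPoint, ProbabilityMeasure.coe_mk,
    integral_add_measure (hint _ _ ENNReal.ofReal_ne_top) (hint _ _ ENNReal.ofReal_ne_top),
    integral_smul_measure, integral_smul_measure, integral_dirac, integral_dirac,
    ENNReal.toReal_ofReal p.2.1, ENNReal.toReal_ofReal (sub_nonneg.2 p.2.2), smul_eq_mul,
    smul_eq_mul]

theorem twoPoint_one (a b : unitInterval) :
    (twoPoint 1 a b : Measure unitInterval) = Measure.dirac a := by
  simp [twoPoint, ProbabilityMeasure.coe_mk]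

/-- The midpoint of the unit interval. -/
noncomputable def half : unitInterval := ⟨1 / 2, by norm_num, by norm_num⟩

theorem measureReal_twoPoint_half_singleton {v : unitInterval} (hv : v = 0 ∨ v = 1) :
    (twoPoint half 1 0 : Measure unitInterval).real {v} = 1 / 2 := by
  have hhalf : (1 - half : ℝ) = 1 / 2 := by norm_num [half]
  rw [twoPoint, ProbabilityMeasure.coe_mk, hhalf]
  rcases hv with rfl | rfl <;> simp [Measure.real, half]

/-- The environment whose arm `0` tosses a fair coin and whose other arms always pay `c`. It is
used with `c` slightly below `1 / 2`: a UCB policy misled by an unlucky start of the coin then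
settles on the constant arms. -/
noncomputable def coinEnv (K : ℕ) [NeZero K] (c : unitInterval) : Env K := fun k =>
  if k = 0 then twoPoint half 1 0 else twoPoint 1 c c

theorem exists_coinEnv_eq_twoPoint (c : unitInterval) (k : Fin K) :
    ∃ p a b, coinEnv K c k = twoPoint p a b := by
  unfold coinEnv
  split_ifs
  · exact ⟨half, 1, 0, rfl⟩
  · exact ⟨1, c, c, rfl⟩

theorem mean_coinEnv_zero (c : unitInterval) : mean (coinEnv K c) 0 = 1 / 2 := by
  rw [mean, coinEnv, if_pos rfl, integral_twoPoint]
  simp [half]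

theorem mean_coinEnv_of_ne (c : unitInterval) {k : Fin K} (hk : k ≠ 0) :
    mean (coinEnv K c) k = c := by
  rw [mean, coinEnv, if_neg hk, integral_twoPoint]
  simp

theorem half_sub_le_gap_coinEnv (c : unitInterval) {k : Fin K} (hk : k ≠ 0) :
    1 / 2 - c ≤ gap (coinEnv K c) k := by
  rw [gap, mean_coinEnv_of_ne c hk, ← mean_coinEnv_zero (K := K) c]
  exact sub_le_sub_right (mean_le_mean_bestArm _ _) _

theorem ae_reward_coinEnv (c : unitInterval) :
    ∀ᵐ ω ∂law (coinEnv K c), ∀ k ≠ 0, ∀ s, ω.1 (k, s) = c := by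
  simp only [ae_all_iff]
  intro k hk s
  have hconst : ∀ᵐ x ∂(coinEnv K c k : Measure unitInterval), x = c := by
    rw [coinEnv, if_neg hk, twoPoint_one, ae_dirac_eq]
    exact mem_pure.2 rfl
  exact (measurePreserving_reward (coinEnv K c) (k, s)).quasiMeasurePreserving.ae hconst

theorem measureReal_coin_eq (c : unitInterval) (s : ℕ) {v : unitInterval} (hv : v = 0 ∨ v = 1) :
    (law (coinEnv K c)).real {ω | (ω.1 (0, s) : ℝ) = v} = 1 / 2 := by
  have hcoin := (measurePreserving_reward (coinEnv K c) (0, s)).measureReal_preimage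
    (measurableSet_singleton v).nullMeasurableSet
  rw [coinEnv, if_pos rfl, measureReal_twoPoint_half_singleton hv] at hcoin
  rw [← hcoin]
  congr 1 with ω
  exact Subtype.coe_inj

theorem choose_div_two_pow_le_measureReal_sum_coin_eq (c : unitInterval) (s m : ℕ) :
    (s.choose m : ℝ) / 2 ^ s ≤
      (law (coinEnv K c)).real {ω | ∑ i ∈ Finset.range s, (ω.1 (0, i) : ℝ) = m} := by
  rcases lt_or_ge s m with hlt | hm
  · simp [Nat.choose_eq_zero_of_lt hlt]
  have h := choose_mul_pow_mul_pow_le_measureReal_sum_range_eq (iIndepFun_reward (coinEnv K c) 0)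
    (fun i => measurable_reward (0, i)) (fun i => measureReal_coin_eq c i (.inr rfl))
    (fun i => measureReal_coin_eq c i (.inl rfl)) s m
  rwa [mul_assoc, ← pow_add, Nat.add_sub_cancel' hm, one_div_pow, mul_one_div] at h

theorem le_ucbIndex_run_of_reward_eq (ρ : ℝ) (σ : Policy K) {ω : Sample K} {k : Fin K}
    {c : unitInterval} (hc : ∀ s, ω.1 (k, s) = c) {t : ℕ} (hk : pulls (run σ ω t) k ≠ 0) :
    c ≤ ucbIndex ρ (run σ ω t) k := by
  rw [ucbIndex_run, sampleMean]
  simp only [hc, Finset.sum_const, Finset.card_range, nsmul_eq_mul]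
  rw [mul_div_cancel_left₀ _ (Nat.cast_ne_zero.2 hk)]
  exact le_add_of_nonneg_right (Real.sqrt_nonneg _)

theorem mul_choose_div_two_pow_le_expRegret_coinEnv {ρ : ℝ} (hρ : 0 ≤ ρ) (hK : 2 ≤ K)
    {σ : Policy K} (hσ : IsUCB ρ σ) {c : unitInterval} (hc : (c : ℝ) ≤ 1 / 2) {s m n : ℕ}
    (hs : s ≠ 0) (hsn : s ≤ n) (hm : m / s + √(ρ * Real.log n / s) < c) :
    (1 / 2 - c : ℝ) * ((n - s) * (s.choose m / 2 ^ s)) ≤ expRegret σ (coinEnv K c) n := by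
  obtain ⟨j, hj⟩ : ∃ j : Fin K, j ≠ 0 :=
    have := Fin.nontrivial_iff_two_le.2 hK
    exists_ne 0
  let E : Set (Sample K) := {ω | ∑ i ∈ Finset.range s, (ω.1 (0, i) : ℝ) = m}
  have hmeas : MeasurableSet E :=
    (Finset.measurable_sum _ fun i _ => measurable_reward (0, i)) (measurableSet_singleton _)
  have hpulls : ∀ᵐ ω ∂law (coinEnv K c), ω ∈ E → pulls (run σ ω n) 0 ≤ s := by
    filter_upwards [ae_arm_mem_support σ (coinEnv K c), ae_reward_coinEnv c] with ω hsupp hconst hω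
    refine pulls_run_le_of_forall_lt_ucbIndex hρ hσ hsupp hs (j := j) (fun t _ ht => ?_) le_rfl
    rw [sampleMean, hω]
    exact hm.trans_le (le_ucbIndex_run_of_reward_eq ρ σ (hconst j hj) ht)
  have hsn' : (0 : ℝ) ≤ n - s := sub_nonneg.2 (Nat.cast_le.2 hsn)
  have : (0 : ℝ) ≤ 1 / 2 - c := sub_nonneg.2 hc
  calc (1 / 2 - c : ℝ) * ((n - s) * (s.choose m / 2 ^ s))
      ≤ (1 / 2 - c : ℝ) * ((n - s) * (law (coinEnv K c)).real E) := by
        gcongr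
        exact choose_div_two_pow_le_measureReal_sum_coin_eq c s m
    _ ≤ (1 / 2 - c : ℝ) * ∫ ω, ((n : ℝ) - pulls (run σ ω n) 0) ∂law (coinEnv K c) := by
        gcongr
        exact mul_measureReal_le_integral_sub_pulls_run σ hmeas hpulls
    _ ≤ expRegret σ (coinEnv K c) n :=
        mul_integral_sub_pulls_run_le_expRegret σ (fun _ => half_sub_le_gap_coinEnv c) n

end CoinEnvironment

section LowerBound

variable {K : ℕ} [NeZero K] {ρ : ℝ}

theorem sq_mul_exp_neg_div_le_expRegret_coinEnv (hρ : 0 ≤ ρ) (hK : 2 ≤ K) {σ : Policy K}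
    (hσ : IsUCB ρ σ) {c : unitInterval} {δ : ℝ} {s n : ℕ} (hδ : 0 < δ) (hδ' : δ ≤ 1 / 8)
    (hc : (c : ℝ) = 1 / 2 - δ ^ 2) (hs : 1 ≤ δ ^ 2 * s) (hlog : ρ * Real.log n ≤ δ ^ 2 * s)
    (hsn : s ≤ n) :
    δ ^ 2 * ((n - s) *
      (Real.exp (-(s * (Real.log 2 - Real.binEntropy (1 / 2 - (δ + 3 * δ ^ 2))))) / (s + 1))) ≤
      expRegret σ (coinEnv K c) n := by
  obtain ⟨m, hm, hmass⟩ :=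
    exists_add_sqrt_lt_and_exp_div_le_choose_div_two_pow hδ hδ' hs hlog
  have hs0 : s ≠ 0 := by
    rintro rfl
    norm_num at hs
  have hsub : (0 : ℝ) ≤ n - s := sub_nonneg.2 (Nat.cast_le.2 hsn)
  calc _ ≤ δ ^ 2 * ((n - s) * (s.choose m / 2 ^ s : ℝ)) := by gcongr
    _ = (1 / 2 - c : ℝ) * ((n - s) * (s.choose m / 2 ^ s)) := by rw [hc, sub_sub_cancel]
    _ ≤ expRegret σ (coinEnv K c) n :=
      mul_choose_div_two_pow_le_expRegret_coinEnv hρ hK hσ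
        (by rw [hc]; linarith [sq_nonneg δ]) hs0 hsn (by rwa [hc])

theorem exists_tendsto_expRegret_coinEnv_div_rpow_atTop (hρ : 0 < ρ) (hK : 2 ≤ K) {r : ℝ}
    (hr : r < 1 - 2 * ρ) :
    ∃ c : unitInterval, ∀ σ : Policy K, IsUCB ρ σ →
      Tendsto (fun n : ℕ => expRegret σ (coinEnv K c) n / (n : ℝ) ^ r) atTop atTop := by
  obtain ⟨δ, hδ, hδ', hexponent⟩ :=
    exists_div_mul_log_two_sub_binEntropy_lt hρ.le (by linarith : 2 * ρ < 1 - r)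
  have hδ2 : 0 < δ ^ 2 := by positivity
  have hc : 0 ≤ 1 / 2 - δ ^ 2 := by nlinarith
  refine ⟨⟨1 / 2 - δ ^ 2, hc, by linarith⟩, fun σ hσ => ?_⟩
  have hC : 0 < ρ / δ ^ 2 := div_pos hρ hδ2
  refine tendsto_atTop_mono' _ ?_ ((tendsto_sub_ceil_log_mul_exp_div_rpow_atTop hC
    (sub_nonneg.2 Real.binEntropy_le_log_two) (lt_sub_comm.1 hexponent)).const_mul_atTop hδ2)
  filter_upwards [(Real.tendsto_log_atTop.comp tendsto_natCast_atTop_atTop).eventually_ge_atTop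
      (1 / ρ), (tendsto_rpow_div_mul_log_add_atTop one_pos hC 1).eventually_ge_atTop 1]
    with n hlog hn
  have hlog' : 1 ≤ ρ * Real.log n := (div_le_iff₀' hρ).1 hlog
  have hClog : 0 ≤ ρ / δ ^ 2 * Real.log n := mul_nonneg hC.le (Real.log_natCast_nonneg n)
  have hceil : ρ * Real.log n ≤ δ ^ 2 * ⌈ρ / δ ^ 2 * Real.log n⌉₊ := by
    rw [← div_le_iff₀' hδ2, ← div_mul_eq_mul_div]
    exact Nat.le_ceil _
  have hceil_le : ⌈ρ / δ ^ 2 * Real.log n⌉₊ ≤ n := by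
    rw [Real.rpow_one, le_div_iff₀ (by positivity), one_mul] at hn
    exact Nat.ceil_le.2 (by linarith)
  rw [← mul_div_assoc]
  gcongr
  exact sq_mul_exp_neg_div_le_expRegret_coinEnv hρ.le hK hσ hδ hδ' rfl (hlog'.trans hceil) hceil
    hceil_le

end LowerBound

end Bandit

open Bandit in
theorem mainTheorem2_general (K : ℕ) [NeZero K] (hK : 2 ≤ K) {ρ : ℝ} (hρ : 0 < ρ) :
    (∀ σ : Policy K, IsUCB ρ σ →
      (∀ (θ : Env K) (β : ℝ), β ∈ Set.Ioo 0 1 → 2 * ρ * β < 1 → ∀ n : ℕ, 1 ≤ n →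
        expRegret σ θ n ≤ ∑ k with 0 < gap θ k,
          (4 * ρ * Real.log n / gap θ k + 2 * gap θ k * (Real.log n / Real.log (1 / β) + 1) *
            ((n : ℝ) ^ (1 - 2 * ρ * β) / (1 - 2 * ρ * β)))) ∧
      ∀ Θ : Set (Env K), IsConsistent (max (1 - 2 * ρ) 0) Θ σ) ∧
    ∀ ε : ℝ, 0 < ε → ∃ θ : Env K, (∀ k, ∃ p a b, θ k = twoPoint p a b) ∧
      ∀ σ : Policy K, IsUCB ρ σ →
        Tendsto (fun n : ℕ => expRegret σ θ n / (n : ℝ) ^ (1 - 2 * ρ - ε)) atTop atTop := by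
  refine ⟨fun σ hσ => ⟨fun θ β hβ hρβ n hn => expRegret_le hρ hσ θ hβ hρβ hn,
    hσ.isConsistent hρ⟩, fun ε hε => ?_⟩
  obtain ⟨c, hc⟩ :=
    exists_tendsto_expRegret_coinEnv_div_rpow_atTop hρ hK (sub_lt_self (1 - 2 * ρ) hε)
  exact ⟨coinEnv K c, exists_coinEnv_eq_twoPoint c, hc⟩

theorem mainTheorem2 (K : ℕ) [NeZero K] (hK : 2 ≤ K)
    (Θ : Fin K → Set (ProbabilityMeasure unitInterval))
    (hΘ : ∀ (k : Fin K) (p a b : unitInterval), Bandit.twoPoint p a b ∈ Θ k)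
    (ρ : ℝ) (hρ : ρ ∈ Set.Ioo (0 : ℝ) (1 / 2)) :
    (∀ σ : Bandit.Policy K, Bandit.IsUCB ρ σ →
      (∀ θ ∈ Set.univ.pi Θ, ∀ β ∈ Set.Ioo (0 : ℝ) 1, ∀ n : ℕ, 1 ≤ n →
        Bandit.expRegret σ θ n ≤
          ∑ k with 0 < Bandit.gap θ k,
            (4 * Real.log n / Bandit.gap θ k +
              2 * Bandit.gap θ k * (Real.log n / Real.log (1 / β) + 1) *
                ((n : ℝ) ^ (1 - 2 * ρ * β) / (1 - 2 * ρ * β)))) ∧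
      Bandit.IsConsistent (1 - 2 * ρ) (Set.univ.pi Θ) σ) ∧
    (∀ ε > (0 : ℝ), ∃ θ ∈ Set.univ.pi Θ, ∀ σ : Bandit.Policy K, Bandit.IsUCB ρ σ →
      Tendsto (fun n : ℕ => Bandit.expRegret σ θ n / (n : ℝ) ^ (1 - 2 * ρ - ε)) atTop atTop) := by
  obtain ⟨hupper, hlower⟩ := mainTheorem2_general K hK hρ.1
  refine ⟨fun σ hσ => ⟨fun θ _ β hβ n hn => ?_, ?_⟩, fun ε hε => ?_⟩
  · have hρβ : 2 * ρ * β < 1 := by nlinarith [hρ.1, hρ.2, hβ.1, hβ.2]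
    refine ((hupper σ hσ).1 θ β hβ hρβ n hn).trans (Finset.sum_le_sum fun k _ => ?_)
    have := Bandit.gap_nonneg θ k
    gcongr
    linarith [hρ.2]
  · simpa only [max_eq_left (by linarith [hρ.2] : 0 ≤ 1 - 2 * ρ)] using (hupper σ hσ).2 _
  · obtain ⟨θ, hθ, hlim⟩ := hlower ε hε
    refine ⟨θ, fun k _ => ?_, hlim⟩
    obtain ⟨p, a, b, hk⟩ := hθ k
    exact hk ▸ hΘ k p a b
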